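/- Let $\theta>0$ and $N\ge 1$ be an integer. For $0\le k\le N$ let $\mathbb W^\theta_{N,k}$ be the set of $(\ell_1,\dots,\ell_k)\in\mathbb R^k$ with $\ell_i=\lambda_i+(N-i)\theta$, $\lambda_i\in\mathbb Z$, $\lambda_1\ge\cdots\ge\lambda_k$. For $m\in\mathbb W^\theta_{N,k}$ and $\ell\in\mathbb W^\theta_{N,k+1}$, with $m_i=\mu_i+(N-i)\theta$ and $\ell_i=\lambda_i+(N-i)\theta$, write $m\preceq\ell$ if $\lambda_{k+1}\le\mu_k\le\lambda_k\le\cdots\le\lambda_2\le\mu_1\le\lambda_1$. Let $\mathfrak X^\theta_{N,N}$ be the set of Gelfand–Tsetlin patterns $(\ell^1,\dots,\ell^N)$ with $\ell^k\in\mathbb W^\theta_{N,k}$ and $\ell^1\preceq\ell^2\preceq\cdots\preceq\ell^N$. For $1\le s\le N$, $\ell\in\mathbb W^\theta_{N,s}$, $m\in\mathbb W^\theta_{N,s-1}$ put $$I(\ell,m)=\frac1{\Gamma(\theta)^{s-1}}\prod_{1\le i<j\le s}\frac{\Gamma(\ell_i-\ell_j+1-\theta)}{\Gamma(\ell_i-\ell_j)}\prod_{1\le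 i<j\le s-1}\frac{\Gamma(m_i-m_j+1)}{\Gamma(m_i-m_j+\theta)}\prod_{1\le i<j\le s}\frac{\Gamma(m_i-\ell_j)}{\Gamma(m_i-\ell_j+1-\theta)}\prod_{1\le i\le j\le s-1}\frac{\Gamma(\ell_i-m_j+\theta)}{\Gamma(\ell_i-m_j+1)}$$ (the Jack skew branching factor). Let $w:\mathbb R\to[0,\infty)$ be such that $$Z=\sum_{\ell\in\mathbb W^\theta_{N,N}}\ \prod_{1\le i<j\le N}\frac{\Gamma(\ell_i-\ell_j+1)\Gamma(\ell_i-\ell_j+\theta)}{\Gamma(\ell_i-\ell_j)\Gamma(\ell_i-\ell_j+1-\theta)}\prod_{i=1}^N w(\ell_i)\in(0,\infty).$$ For $(\ell^1,\dots,\ell^N)\in\mathfrak X^\theta_{N,N}$ define $$\mathbb P(\ell^1,\dots,\ell^N)=\prod_{i=1}^N\frac{\Gamma(i\theta)}{\Gamma(\theta)}\cdot\frac1Z\prod_{1\le i<j\le N}\frac{\Gamma(\ell^N_i-\ell^N_j+1)}{\Gamma(\ell^N_i-\ell^N_j+1-\theta)}\cdot\prod_{k=1}^{N-1}I(\ell^{k+1},\ell^k)\cdot\prod_{i=1}^N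 w(\ell^N_i).$$ Then $\mathbb P$ is a (nonnegative) probability mass function on $\mathfrak X^\theta_{N,N}$. The law of its projection on the top level $\ell^N$ is the discrete $\beta$-ensemble: for every $\ell\in\mathbb W^\theta_{N,N}$, $$\mathbb P(\ell^N=\ell)=\frac1Z\prod_{1\le i<j\le N}\frac{\Gamma(\ell_i-\ell_j+1)\Gamma(\ell_i-\ell_j+\theta)}{\Gamma(\ell_i-\ell_j)\Gamma(\ell_i-\ell_j+1-\theta)}\prod_{i=1}^N w(\ell_i).$$ The law of its projection on the top two levels is, for all $\ell\in\mathbb W^\theta_{N,N}$ and $m\in\mathbb W^\theta_{N,N-1}$ with $m\preceq\ell$, $$\mathbb P(\ell^N=\ell,\ \ell^{N-1}=m)=\frac{\Gamma(N\theta)}{\Gamma(\theta)}\cdot\frac1Z\cdot H^t(\ell)\,H^b(m)\,I(\ell,m),$$ where $$H^t(\ell)=\prod_{1\le i<j\le N}\frac{\Gamma(\ell_i-\ell_j+1)}{\Gamma(\ell_i-\ell_j+1-\theta)}\prod_{i=1}^N w(\ell_i),\qquad H^b(m)=\prod_{1\le i<j\le N-1}\frac{\Gamma(m_i-m_j+\theta)}{\Gamma(m_i-m_j)}.$$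 (For $N=1$ the level $\ell^0$ is the empty tuple, and empty products equal $1$.) -/

import Mathlib

open scoped ENNReal

noncomputable section

/-- Shifted coordinates `ℓ_i = λ_i + (N - i) θ`, `i = 1, …, k`, of an integer tuple `λ`
(the index `i` runs over `Fin k`, so the mathematical index is `i + 1`). -/
def shiftedCoord (θ : ℝ) (N : ℕ) {k : ℕ} (a : Fin k → ℤ) : Fin k → ℝ :=
  fun i => (a i : ℝ) + ((N : ℝ) - ((i : ℕ) + 1 : ℝ)) * θ

/-- The set `𝕎^θ_{N,k}`: shifted coordinates of signatures `λ_1 ≥ ⋯ ≥ λ_k`, `λ_i ∈ ℤ`. -/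
def stateW (θ : ℝ) (N k : ℕ) : Set (Fin k → ℝ) :=
  {l | ∃ a : Fin k → ℤ, Antitone a ∧ l = shiftedCoord θ N a}

/-- The relation `m ⪯ ℓ`: the underlying integer tuples `μ` of `m` and `λ` of `ℓ` interlace,
`λ_{k+1} ≤ μ_k ≤ λ_k ≤ ⋯ ≤ λ_2 ≤ μ_1 ≤ λ_1`. -/
def Interlaces (θ : ℝ) (N : ℕ) {k : ℕ} (m : Fin k → ℝ) (l : Fin (k + 1) → ℝ) : Prop :=
  ∃ (b : Fin k → ℤ) (a : Fin (k + 1) → ℤ),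
    m = shiftedCoord θ N b ∧ l = shiftedCoord θ N a ∧
      ∀ i : Fin k, a i.succ ≤ b i ∧ b i ≤ a i.castSucc

/-- Arrays `(ℓ^1, …, ℓ^N)` with `ℓ^k ∈ ℝ^k`. The component of index `0` is the empty tuple, the
only element of `Fin 0 → ℝ`; it carries no information. -/
abbrev LevelArray (N : ℕ) : Type := (k : Fin (N + 1)) → Fin (k : ℕ) → ℝ

/-- The set `𝔛^θ_{N,N}` of Gelfand–Tsetlin patterns `ℓ^1 ⪯ ℓ^2 ⪯ ⋯ ⪯ ℓ^N` with
`ℓ^k ∈ 𝕎^θ_{N,k}`. (The conditions on the empty level are vacuous.) -/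
def patternSpace (θ : ℝ) (N : ℕ) : Set (LevelArray N) :=
  {p | (∀ k : Fin (N + 1), p k ∈ stateW θ N k) ∧
    ∀ k : Fin N, Interlaces θ N (k := (k : ℕ)) (p k.castSucc) (p k.succ)}

/-- The set of pairs `(ℓ, m) ∈ 𝕎^θ_{N,N} × 𝕎^θ_{N,N-1}` with `m ⪯ ℓ`, where `N = n + 1`. -/
def twoLevelSpace (θ : ℝ) (n : ℕ) : Set ((Fin (n + 1) → ℝ) × (Fin n → ℝ)) :=
  {q | q.1 ∈ stateW θ (n + 1) (n + 1) ∧ q.2 ∈ stateW θ (n + 1) n ∧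
    Interlaces θ (n + 1) q.2 q.1}

/-- The projection `(ℓ^1, …, ℓ^N) ↦ ℓ^N`. -/
def topLevel (θ : ℝ) (N : ℕ) (p : patternSpace θ N) : stateW θ N N :=
  ⟨p.1 (Fin.last N), p.2.1 (Fin.last N)⟩

/-- The projection `(ℓ^1, …, ℓ^N) ↦ (ℓ^N, ℓ^{N-1})`, where `N = n + 1`. -/
def topTwoLevels (θ : ℝ) (n : ℕ) (p : patternSpace θ (n + 1)) : twoLevelSpace θ n :=
  ⟨(p.1 (Fin.last (n + 1)), p.1 (Fin.last n).castSucc),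
    p.2.1 (Fin.last (n + 1)), p.2.1 (Fin.last n).castSucc, p.2.2 (Fin.last n)⟩

/-- The branching factor `I(ℓ, m)` for `ℓ` of length `s = k + 1` and `m` of length `s - 1 = k`.
It includes the normalization `Γ(θ)^{-(s-1)}`, which makes it the value at `1` of the skew Jack
function in one variable (so that `I = 1` when all the integer coordinates vanish). -/
def jackI (θ : ℝ) {k : ℕ} (l : Fin (k + 1) → ℝ) (m : Fin k → ℝ) : ℝ :=
  (Real.Gamma θ ^ k)⁻¹ *
  (∏ i : Fin (k + 1), ∏ j ∈ Finset.Ioi i,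
    Real.Gamma (l i - l j + 1 - θ) / Real.Gamma (l i - l j)) *
  (∏ i : Fin k, ∏ j ∈ Finset.Ioi i,
    Real.Gamma (m i - m j + 1) / Real.Gamma (m i - m j + θ)) *
  (∏ i : Fin k, ∏ j ∈ Finset.Ioi i.castSucc,
    Real.Gamma (m i - l j) / Real.Gamma (m i - l j + 1 - θ)) *
  (∏ i : Fin k, ∏ j ∈ Finset.Ici i,
    Real.Gamma (l i.castSucc - m j + θ) / Real.Gamma (l i.castSucc - m j + 1))

/-- The factor `H^t(ℓ)` of the top level. -/
def topFactor (θ : ℝ) (w : ℝ → ℝ) {N : ℕ} (l : Fin N → ℝ) : ℝ :=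
  (∏ i : Fin N, ∏ j ∈ Finset.Ioi i,
    Real.Gamma (l i - l j + 1) / Real.Gamma (l i - l j + 1 - θ)) * ∏ i : Fin N, w (l i)

/-- The factor `H^b(m)` of the second level (with `τ ≡ 1`). -/
def bottomFactor (θ : ℝ) {k : ℕ} (m : Fin k → ℝ) : ℝ :=
  ∏ i : Fin k, ∏ j ∈ Finset.Ioi i,
    Real.Gamma (m i - m j + θ) / Real.Gamma (m i - m j)

/-- The unnormalized weight of `ℓ` in the discrete `β`-ensemble with weight function `w`. -/
def betaWeight (θ : ℝ) (w : ℝ → ℝ) {N : ℕ} (l : Fin N → ℝ) : ℝ :=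
  (∏ i : Fin N, ∏ j ∈ Finset.Ioi i,
    Real.Gamma (l i - l j + 1) * Real.Gamma (l i - l j + θ) /
      (Real.Gamma (l i - l j) * Real.Gamma (l i - l j + 1 - θ))) * ∏ i : Fin N, w (l i)

/-- The partition function `Z`, a sum in `[0, ∞]`. -/
def partitionZ (θ : ℝ) (N : ℕ) (w : ℝ → ℝ) : ℝ≥0∞ :=
  ∑' l : stateW θ N N, ENNReal.ofReal (betaWeight θ w l.1)

/-- The multilevel formula `ℙ^{θ,N}_N(ℓ^1, …, ℓ^N)`. In the product over `k`, the factor of index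
`0` is the empty product `I(ℓ^1, ∅) = 1`. -/
def multilevelFormula (θ : ℝ) (N : ℕ) (w : ℝ → ℝ) (p : LevelArray N) : ℝ :=
  (∏ i ∈ Finset.Icc 1 N, Real.Gamma (i * θ) / Real.Gamma θ) * (partitionZ θ N w).toReal⁻¹ *
    (∏ i : Fin N, ∏ j ∈ Finset.Ioi i,
      Real.Gamma (p (Fin.last N) i - p (Fin.last N) j + 1) /
        Real.Gamma (p (Fin.last N) i - p (Fin.last N) j + 1 - θ)) *
    (∏ k : Fin N, jackI θ (k := (k : ℕ)) (p k.succ) (p k.castSucc)) *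
    ∏ i : Fin N, w (p (Fin.last N) i)

end

/-! Everything rests on the branching rule `sum_jackI_mul_bottomFactor`: summing `jackI θ l m *
bottomFactor θ m` over `m ⪯ l` returns `bottomFactor θ l` times Γ(θ)/Γ((k+1)θ). Iterating it down
the pattern, the patterns with top row `l` have total weight `bottomFactor θ l / levelConst θ N`
(`patternSum_eq`). Multiplied by the prefactor of the law this is the β-ensemble weight over Z, and
summing over `l` gives total mass 1. Stopping one level earlier gives the two-level law.

Multiplying `jackI` by `bottomFactor` turns the pair factors of `m` into a Vandermonde product, so
the rule becomes the evaluation of `branchSum`, a discrete Dixon–Anderson sum (`branchSum_eq`). The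
weight of each coordinate satisfies a first-order difference equation, which telescopes to show that
the weight annihilates R(x) = ∏(x - l_j) - ∏(x - l_j - θ), of degree k with leading coefficient
(k+1)θ. All k coordinates share this R, so inserting ∏(c - x_i) into the Vandermonde sum multiplies
it by R(c)/((k+1)θ) (`sum_diffProd_insert`).

Now raise one part of the signature by 1. The old sum with c = l_r + θ inserted equals the new sum
with c = l_r + 1 inserted (`branch_insert_shift`), which gives the ratio of the two branching sums.
`gammaPairs` has the same ratio, so induction reduces the claim to constant signatures, where a
single term remains. -/

/-! ### Vandermonde sums against measures with a common annihilated polynomial. -/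

/-- The product of the differences `x i - x j` over `i < j`. -/
def diffProd {k : ℕ} (x : Fin k → ℝ) : ℝ :=
  ∏ i : Fin k, ∏ j ∈ Finset.Ioi i, (x i - x j)

/-- The homogeneous first row covers two cases at once: d = 1 inserts the point c, while (c, d) =
(1, 0) is the point at infinity, whose row is the last unit vector and which inserts only a sign. -/
theorem det_cons_projective_vandermonde {k : ℕ} (x : Fin k → ℝ) (c d : ℝ) :
    Matrix.det (Fin.cons (fun j : Fin (k + 1) => c ^ (j : ℕ) * d ^ ((j.rev : Fin (k + 1)) : ℕ))
      (fun i (j : Fin (k + 1)) => x i ^ (j : ℕ)) : Matrix (Fin (k + 1)) (Fin (k + 1)) ℝ) =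
      (∏ i, (x i * d - c)) * ∏ i : Fin k, ∏ j ∈ Finset.Ioi i, (x j - x i) := by
  have h := Matrix.det_projVandermonde (R := ℝ) (Fin.cons c x : Fin (k + 1) → ℝ)
    (Fin.cons d (fun _ => 1))
  rw [Fin.prod_univ_succ] at h
  simp only [Fin.cons_zero, Fin.cons_succ, Fin.prod_Ioi_zero, Fin.prod_Ioi_succ, mul_one] at h
  rw [← h]
  congr 1
  ext i j
  refine Fin.cases ?_ (fun i => ?_) i <;> simp [Matrix.projVandermonde_apply]

theorem multilinear_sum_rows {k : ℕ} {ι : Type*}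
    (L : MultilinearMap ℝ (fun _ : Fin k => Fin (k + 1) → ℝ) ℝ) (X : Fin k → Finset ι)
    (f : Fin k → ι → ℝ) (x : Fin k → ι → ℝ) :
    L (fun i => ∑ b ∈ X i, f i b • fun j : Fin (k + 1) => x i b ^ (j : ℕ)) =
      ∑ b ∈ Fintype.piFinset X, (∏ i, f i (b i)) *
        L (fun i (j : Fin (k + 1)) => x i (b i) ^ (j : ℕ)) := by
  rw [MultilinearMap.map_sum_finset]
  refine Finset.sum_congr rfl fun b _ => ?_
  rw [L.map_smul_univ (fun i => f i (b i)) (fun i (j : Fin (k + 1)) => x i (b i) ^ (j : ℕ)),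
    smul_eq_mul]

theorem prod_diff_reverse {k : ℕ} (x : Fin k → ℝ) :
    (∏ i : Fin k, ∏ j ∈ Finset.Ioi i, (x j - x i)) =
      (∏ i : Fin k, ∏ _j ∈ Finset.Ioi i, (-1 : ℝ)) * diffProd x := by
  simp only [diffProd, ← Finset.prod_mul_distrib]
  refine Finset.prod_congr rfl fun i _ => Finset.prod_congr rfl fun j _ => ?_
  ring

/-- If a polynomial `R` of degree `k` is annihilated by each of `k` finitely supported measures,
then inserting `∏ (c - x_i)` in the Vandermonde sum multiplies it by `R(c)` over the leading
coefficient of `R`. -/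
theorem sum_diffProd_insert {k : ℕ} {ι : Type*} (X : Fin k → Finset ι) (f : Fin k → ι → ℝ)
    (x : Fin k → ι → ℝ) (R : Polynomial ℝ) (hdeg : R.natDegree < k + 1) (hR : R.coeff k ≠ 0)
    (hann : ∀ i, ∑ b ∈ X i, f i b * R.eval (x i b) = 0) (c : ℝ) :
    R.coeff k * ∑ b ∈ Fintype.piFinset X,
        (∏ i, f i (b i)) * (∏ i, (c - x i (b i))) * diffProd (fun i => x i (b i)) =
      R.eval c * ∑ b ∈ Fintype.piFinset X,
        (∏ i, f i (b i)) * diffProd (fun i => x i (b i)) := by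
  set L := (Matrix.detRowAlternating (R := ℝ) (n := Fin (k + 1))).toMultilinearMap.curryLeft
    with hL
  set M : Fin k → Fin (k + 1) → ℝ :=
    fun i => ∑ b ∈ X i, f i b • fun j : Fin (k + 1) => x i b ^ (j : ℕ) with hM
  set s : ℝ := ∏ i : Fin k, ∏ _j ∈ Finset.Ioi i, (-1 : ℝ) with hs
  have hs0 : s ≠ 0 := by
    simp [hs, Finset.prod_ne_zero_iff]
  have key (c d : ℝ) : L (fun j : Fin (k + 1) => c ^ (j : ℕ) * d ^ ((j.rev : Fin (k + 1)) : ℕ)) M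
      = s * ∑ b ∈ Fintype.piFinset X,
        (∏ i, f i (b i)) * (∏ i, (x i (b i) * d - c)) * diffProd (fun i => x i (b i)) := by
    rw [hM, multilinear_sum_rows, Finset.mul_sum]
    refine Finset.sum_congr rfl fun b _ => ?_
    have : L (fun j : Fin (k + 1) => c ^ (j : ℕ) * d ^ ((j.rev : Fin (k + 1)) : ℕ))
        (fun i (j : Fin (k + 1)) => x i (b i) ^ (j : ℕ)) = _ :=
      det_cons_projective_vandermonde (fun i => x i (b i)) c d
    rw [this, prod_diff_reverse]
    ring
  -- The coefficient vector of R is in the kernel of the matrix: the moment rows kill it by `hann`,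
  -- and the first row pairs with it to R.coeff k · R(c) - R(c) · R.coeff k. It is nonzero, so the
  -- determinant vanishes.
  have hker : L (R.coeff k • (fun j : Fin (k + 1) => c ^ (j : ℕ) * 1 ^ ((j.rev : Fin (k + 1)) : ℕ))
      - R.eval c • (fun j : Fin (k + 1) => (1 : ℝ) ^ (j : ℕ) * 0 ^ ((j.rev : Fin (k + 1)) : ℕ))) M
      = 0 := by
    refine Matrix.exists_mulVec_eq_zero_iff.mp ⟨fun j => R.coeff j, fun h => hR ?_, ?_⟩
    · simpa using congrFun h (Fin.last k)
    · ext i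
      refine Fin.cases ?_ (fun i => ?_) i
      · simp only [Matrix.mulVec, dotProduct, Fin.cons_zero, Pi.sub_apply, Pi.smul_apply,
          smul_eq_mul, one_pow, mul_one, one_mul, Pi.zero_apply, sub_mul, Finset.sum_sub_distrib]
        have h0 : ∑ j : Fin (k + 1), R.eval c * 0 ^ ((j.rev : Fin (k + 1)) : ℕ) * R.coeff j =
            R.eval c * R.coeff k := by
          rw [Finset.sum_eq_single (Fin.last k)]
          · simp
          · intro j _ hj
            rw [zero_pow, mul_zero, zero_mul]
            intro h
            apply hj
            have := Fin.rev_eq_iff.mp (Fin.ext h : j.rev = 0)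
            simpa using this
          · simp
        rw [h0, Polynomial.eval_eq_sum_range' hdeg, ← Fin.sum_univ_eq_sum_range
          (fun i => R.coeff i * c ^ i), Finset.sum_mul, sub_eq_zero]
        exact Finset.sum_congr rfl fun j _ => by ring
      · simp only [Matrix.mulVec, dotProduct, Fin.cons_succ, Pi.zero_apply]
        rw [← hann i]
        simp only [hM, Finset.sum_apply, Pi.smul_apply, smul_eq_mul, Finset.sum_mul]
        rw [Finset.sum_comm]
        refine Finset.sum_congr rfl fun b _ => ?_
        rw [Polynomial.eval_eq_sum_range' hdeg, ← Fin.sum_univ_eq_sum_range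
          (fun j => R.coeff j * x i b ^ j), Finset.mul_sum]
        exact Finset.sum_congr rfl fun j _ => by ring
  rw [map_sub, map_smul, map_smul, sub_apply, smul_apply,
    smul_apply, key, key, smul_eq_mul, smul_eq_mul, sub_eq_zero] at hker
  have hsign (b : Fin k → ι) : ∏ i, (x i (b i) * 1 - c) = (-1) ^ k * ∏ i, (c - x i (b i)) := by
    have : (-1 : ℝ) ^ k = ∏ _i : Fin k, (-1 : ℝ) := by simp
    rw [this, ← Finset.prod_mul_distrib]
    exact Finset.prod_congr rfl fun i _ => by ring
  simp only [hsign, mul_zero, zero_sub, Finset.prod_const, Finset.card_univ, Fintype.card_fin]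
    at hker
  apply mul_left_cancel₀ (mul_ne_zero hs0 (pow_ne_zero k (neg_ne_zero.mpr one_ne_zero)) :
    s * (-1 : ℝ) ^ k ≠ 0)
  convert hker using 1
  · simp only [Finset.mul_sum]
    exact Finset.sum_congr rfl fun b _ => by ring
  · simp only [Finset.mul_sum]
    exact Finset.sum_congr rfl fun b _ => by ring

theorem coeff_prod_sub_prod {k : ℕ} (u v : Fin (k + 1) → ℝ) :
    (∏ j, (Polynomial.X - Polynomial.C (u j)) -
      ∏ j, (Polynomial.X - Polynomial.C (v j))).coeff k = ∑ j, (v j - u j) := by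
  have h (u : Fin (k + 1) → ℝ) := Polynomial.prod_X_sub_C_coeff_card_pred Finset.univ u (by simp)
  simp only [Finset.card_univ, Fintype.card_fin, Nat.add_sub_cancel] at h
  rw [Polynomial.coeff_sub, h, h, Finset.sum_sub_distrib]
  ring

theorem natDegree_prod_sub_prod_lt {k : ℕ} (u v : Fin (k + 1) → ℝ) :
    (∏ j, (Polynomial.X - Polynomial.C (u j)) -
      ∏ j, (Polynomial.X - Polynomial.C (v j))).natDegree < k + 1 := by
  have h (u : Fin (k + 1) → ℝ) : (∏ j, (Polynomial.X - Polynomial.C (u j))).Monic :=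
    Polynomial.monic_prod_of_monic _ _ fun j _ => Polynomial.monic_X_sub_C _
  have hd (u : Fin (k + 1) → ℝ) : (∏ j, (Polynomial.X - Polynomial.C (u j))).natDegree = k + 1 := by
    simp
  by_cases h0 : ∏ j, (Polynomial.X - Polynomial.C (u j)) -
      ∏ j, (Polynomial.X - Polynomial.C (v j)) = 0
  · simp [h0]
  rw [Polynomial.natDegree_lt_iff_degree_lt h0]
  have := Polynomial.degree_sub_lt_left (p := ∏ j, (Polynomial.X - Polynomial.C (u j)))
    (q := ∏ j, (Polynomial.X - Polynomial.C (v j)))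
    (by rw [Polynomial.degree_eq_natDegree (h u).ne_zero,
      Polynomial.degree_eq_natDegree (h v).ne_zero, hd, hd]) (h u).ne_zero
    (by rw [(h u).leadingCoeff, (h v).leadingCoeff])
  rwa [Polynomial.degree_eq_natDegree (h u).ne_zero, hd] at this

/-! ### The one-coordinate weight and its difference equation. -/

/-- The weight of a single coordinate `x = m i` in the branching sum over `m ⪯ l`. -/
noncomputable def levelWeight (θ : ℝ) {k : ℕ} (l : Fin (k + 1) → ℝ) (i : Fin k) (x : ℝ) : ℝ :=
  ∏ j : Fin (k + 1), if i.castSucc < j then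
    Real.Gamma (x - l j) / Real.Gamma (x - l j + 1 - θ)
  else Real.Gamma (l j - x + θ) / Real.Gamma (l j - x + 1)

/-- The points which lie above `l j + θ` for `j > i` and below `l j` for `j ≤ i`. -/
def IsBetween (θ : ℝ) {k : ℕ} (l : Fin (k + 1) → ℝ) (i : Fin k) (x : ℝ) : Prop :=
  (∀ j, i.castSucc < j → θ ≤ x - l j) ∧ ∀ j, j ≤ i.castSucc → 0 ≤ l j - x

theorem gamma_sub_one {y : ℝ} (hy : y - 1 ≠ 0) :
    Real.Gamma y = (y - 1) * Real.Gamma (y - 1) := by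
  rw [← Real.Gamma_add_one hy, sub_add_cancel]

/-- A discrete Pearson equation, valid factor by factor through Γ(y+1) = yΓ(y). For j ≤ i the two
linear factors appear with opposite sign, and the signs cancel. `IsBetween` keeps the Gamma
arguments that are cancelled positive. -/
theorem levelWeight_pearson {θ : ℝ} (hθ : 0 < θ) {k : ℕ} {l : Fin (k + 1) → ℝ} {i : Fin k}
    {x : ℝ} (h : IsBetween θ l i x) (h' : IsBetween θ l i (x + 1)) :
    levelWeight θ l i (x + 1) * ∏ j, (x + 1 - (l j + θ)) =
      levelWeight θ l i x * ∏ j, (x - l j) := by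
  simp only [levelWeight, ← Finset.prod_mul_distrib]
  refine Finset.prod_congr rfl fun j _ => ?_
  split_ifs with hj
  · have h1 := h.1 j hj
    have e1 : Real.Gamma (x + 1 - l j) = (x - l j) * Real.Gamma (x - l j) := by
      rw [← Real.Gamma_add_one (by linarith)]; ring_nf
    have e2 : Real.Gamma (x + 1 - l j + 1 - θ) =
        (x + 1 - (l j + θ)) * Real.Gamma (x - l j + 1 - θ) := by
      have : x + 1 - (l j + θ) = x - l j + 1 - θ := by ring
      rw [this, ← Real.Gamma_add_one (by linarith)]; ring_nf
    have n1 : x + 1 - (l j + θ) ≠ 0 := by linarith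
    have n2 := (Real.Gamma_pos_of_pos (show 0 < x - l j + 1 - θ by linarith)).ne'
    rw [e1, e2]
    field_simp
  · have h1 := h'.2 j (not_lt.mp hj)
    have e1 : Real.Gamma (l j - x + θ) =
        -(x + 1 - (l j + θ)) * Real.Gamma (l j - (x + 1) + θ) := by
      have : -(x + 1 - (l j + θ)) = l j - (x + 1) + θ := by ring
      rw [this, ← Real.Gamma_add_one (by linarith)]; ring_nf
    have e2 : Real.Gamma (l j - x + 1) = -(x - l j) * Real.Gamma (l j - (x + 1) + 1) := by
      have : l j - (x + 1) + 1 = -(x - l j) := by ring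
      rw [this, ← Real.Gamma_add_one (by linarith)]; ring_nf
    have n1 : x - l j ≠ 0 := by linarith
    have n2 := (Real.Gamma_pos_of_pos (show 0 < l j - (x + 1) + 1 by linarith)).ne'
    rw [e1, e2]
    field_simp

theorem sum_Icc_telescope (p q : ℤ) (u v : ℤ → ℝ)
    (h : ∀ b, p ≤ b → b < q → v (b + 1) = u b) (hu : u q = 0) (hv : v p = 0) :
    ∑ b ∈ Finset.Icc p q, (u b - v b) = 0 := by
  rcases lt_or_ge q p with hqp | hpq
  · simp [Finset.Icc_eq_empty_of_lt hqp]
  have h1 : ∑ b ∈ Finset.Icc p q, u b = ∑ b ∈ Finset.Ico p q, u b := by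
    rw [← Finset.Ico_insert_right hpq, Finset.sum_insert Finset.right_notMem_Ico, hu, zero_add]
  have h2 : ∑ b ∈ Finset.Icc p q, v b = ∑ b ∈ Finset.Ioc p q, v b := by
    rw [← Finset.Ioc_insert_left hpq, Finset.sum_insert Finset.left_notMem_Ioc, hv, zero_add]
  rw [Finset.sum_sub_distrib, sub_eq_zero, h1, h2]
  refine Finset.sum_bij (fun b _ => b + 1) ?_ ?_ ?_ ?_
  · intro b hb; simp only [Finset.mem_Ico, Finset.mem_Ioc] at *; omega
  · intro b _ c _ h; simpa using h
  · intro b hb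
    refine ⟨b - 1, ?_, by ring⟩
    simp only [Finset.mem_Ico, Finset.mem_Ioc] at *; omega
  · intro b hb
    rw [Finset.mem_Ico] at hb
    exact (h b hb.1 hb.2).symm

/-- The shifted coordinate at position `i` of the integer `b`. -/
def shiftedPoint (θ : ℝ) (N : ℕ) {k : ℕ} (i : Fin k) (b : ℤ) : ℝ :=
  (b : ℝ) + ((N : ℝ) - ((i : ℕ) + 1 : ℝ)) * θ

theorem shiftedPoint_add_one (θ : ℝ) (N : ℕ) {k : ℕ} (i : Fin k) (b : ℤ) :
    shiftedPoint θ N i (b + 1) = shiftedPoint θ N i b + 1 := by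
  simp [shiftedPoint]; ring

theorem isBetween_shiftedPoint {θ : ℝ} (hθ : 0 < θ) (N : ℕ) {k : ℕ} {a : Fin (k + 1) → ℤ}
    (ha : Antitone a) {i : Fin k} {b : ℤ} (hb : b ∈ Finset.Icc (a i.succ) (a i.castSucc)) :
    IsBetween θ (shiftedCoord θ N a) i (shiftedPoint θ N i b) := by
  rw [Finset.mem_Icc] at hb
  constructor
  · intro j hj
    have h1 : (a j : ℝ) ≤ b := by
      exact_mod_cast (ha (Fin.castSucc_lt_iff_succ_le.mp hj)).trans hb.1
    have h2 : ((i : ℕ) : ℝ) + 1 ≤ (j : ℕ) := by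
      have : (i : ℕ) < j := hj
      exact_mod_cast this
    simp only [shiftedPoint, shiftedCoord]
    nlinarith
  · intro j hj
    have h1 : (b : ℝ) ≤ a j := by exact_mod_cast hb.2.trans (ha hj)
    have h2 : ((j : ℕ) : ℝ) ≤ (i : ℕ) := by
      have : (j : ℕ) ≤ i := hj
      exact_mod_cast this
    simp only [shiftedPoint, shiftedCoord]
    nlinarith

open Polynomial in
-- The Pearson equation makes the sum telescope, and the polynomial factors kill both boundary
-- terms.
theorem levelWeight_annihilates {θ : ℝ} (hθ : 0 < θ) (N : ℕ) {k : ℕ} {a : Fin (k + 1) → ℤ}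
    (ha : Antitone a) (i : Fin k) :
    ∑ b ∈ Finset.Icc (a i.succ) (a i.castSucc),
      levelWeight θ (shiftedCoord θ N a) i (shiftedPoint θ N i b) *
        (∏ j, (X - C (shiftedCoord θ N a j)) - ∏ j, (X - C (shiftedCoord θ N a j + θ))).eval
          (shiftedPoint θ N i b) = 0 := by
  simp only [eval_sub, eval_prod, eval_X, eval_C, mul_sub]
  refine sum_Icc_telescope _ _
    (fun b => levelWeight θ (shiftedCoord θ N a) i (shiftedPoint θ N i b) *
      ∏ j, (shiftedPoint θ N i b - shiftedCoord θ N a j))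
    (fun b => levelWeight θ (shiftedCoord θ N a) i (shiftedPoint θ N i b) *
      ∏ j, (shiftedPoint θ N i b - (shiftedCoord θ N a j + θ))) ?_ ?_ ?_
  · intro b h1 h2
    have hb := isBetween_shiftedPoint hθ N ha (Finset.mem_Icc.mpr ⟨h1, h2.le⟩)
    have hb' := isBetween_shiftedPoint hθ N ha (b := b + 1) (i := i)
      (Finset.mem_Icc.mpr ⟨by omega, by omega⟩)
    rw [shiftedPoint_add_one] at hb'
    simp only [shiftedPoint_add_one]
    exact levelWeight_pearson hθ hb hb'
  -- The upper endpoint is the point x = l_i.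
  · refine mul_eq_zero_of_right _ (Finset.prod_eq_zero (Finset.mem_univ i.castSucc) ?_)
    simp [shiftedPoint, shiftedCoord]
  -- The lower endpoint is x = l_{i+1} + θ, since position i carries one more θ than position i + 1.
  · refine mul_eq_zero_of_right _ (Finset.prod_eq_zero (Finset.mem_univ i.succ) ?_)
    simp [shiftedPoint, shiftedCoord]
    ring

/-! ### The branching sum under a unit shift of one part. -/

/-- The unnormalized branching sum. -/
noncomputable def branchSum (θ : ℝ) (N : ℕ) {k : ℕ} (a : Fin (k + 1) → ℤ) : ℝ :=
  ∑ b ∈ Fintype.piFinset fun i : Fin k => Finset.Icc (a i.succ) (a i.castSucc),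
    (∏ i, levelWeight θ (shiftedCoord θ N a) i (shiftedPoint θ N i (b i))) *
      diffProd (fun i => shiftedPoint θ N i (b i))

open Polynomial in
theorem branchSum_insert {θ : ℝ} (hθ : 0 < θ) (N : ℕ) {k : ℕ} {a : Fin (k + 1) → ℤ}
    (ha : Antitone a) (c : ℝ) :
    ((k + 1 : ℕ) * θ) * (∑ b ∈ Fintype.piFinset fun i : Fin k =>
        Finset.Icc (a i.succ) (a i.castSucc),
      (∏ i, levelWeight θ (shiftedCoord θ N a) i (shiftedPoint θ N i (b i)) *
        (c - shiftedPoint θ N i (b i))) *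
      diffProd (fun i => shiftedPoint θ N i (b i))) =
    (∏ j, (c - shiftedCoord θ N a j) - ∏ j, (c - (shiftedCoord θ N a j + θ))) *
      branchSum θ N a := by
  have hc := coeff_prod_sub_prod (shiftedCoord θ N a) (fun j => shiftedCoord θ N a j + θ)
  simp only [add_sub_cancel_left, Finset.sum_const, Finset.card_univ, Fintype.card_fin,
    nsmul_eq_mul] at hc
  have h := sum_diffProd_insert (fun i : Fin k => Finset.Icc (a i.succ) (a i.castSucc))
    (fun i b => levelWeight θ (shiftedCoord θ N a) i (shiftedPoint θ N i b))
    (fun i b => shiftedPoint θ N i b)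
    (∏ j, (X - C (shiftedCoord θ N a j)) - ∏ j, (X - C (shiftedCoord θ N a j + θ)))
    (natDegree_prod_sub_prod_lt _ _) (by rw [hc]; positivity)
    (levelWeight_annihilates hθ N ha) c
  rw [hc] at h
  simp only [eval_sub, eval_prod, eval_X, eval_C] at h
  simp only [Finset.prod_mul_distrib]
  exact h

theorem shiftedCoord_update (θ : ℝ) (N : ℕ) {k : ℕ} (a : Fin k → ℤ) (r : Fin k) :
    shiftedCoord θ N (Function.update a r (a r + 1)) =
      Function.update (shiftedCoord θ N a) r (shiftedCoord θ N a r + 1) := by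
  ext j
  rcases eq_or_ne j r with rfl | h
  · simp [shiftedCoord]; ring
  · simp [shiftedCoord, h]

/-- Only the factor j = r changes. The ratio has the same form whether r lies above or below the
coordinate, so no case distinction survives in the statement. -/
theorem levelWeight_shift {θ : ℝ} (hθ : 0 < θ) {k : ℕ} {l : Fin (k + 1) → ℝ} {i : Fin k}
    {x : ℝ} (r : Fin (k + 1)) (h : IsBetween θ l i x)
    (h' : IsBetween θ (Function.update l r (l r + 1)) i x) :
    levelWeight θ l i x * (l r + θ - x) =
      levelWeight θ (Function.update l r (l r + 1)) i x * (l r + 1 - x) := by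
  unfold levelWeight
  rw [← Finset.mul_prod_erase _ _ (Finset.mem_univ r), ← Finset.mul_prod_erase _
    (fun j => if i.castSucc < j then
      Real.Gamma (x - Function.update l r (l r + 1) j) /
        Real.Gamma (x - Function.update l r (l r + 1) j + 1 - θ)
      else Real.Gamma (Function.update l r (l r + 1) j - x + θ) /
        Real.Gamma (Function.update l r (l r + 1) j - x + 1)) (Finset.mem_univ r)]
  have hrest : ∏ j ∈ Finset.univ.erase r, (if i.castSucc < j then
      Real.Gamma (x - Function.update l r (l r + 1) j) /
        Real.Gamma (x - Function.update l r (l r + 1) j + 1 - θ)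
      else Real.Gamma (Function.update l r (l r + 1) j - x + θ) /
        Real.Gamma (Function.update l r (l r + 1) j - x + 1)) =
      ∏ j ∈ Finset.univ.erase r, (if i.castSucc < j then
        Real.Gamma (x - l j) / Real.Gamma (x - l j + 1 - θ)
        else Real.Gamma (l j - x + θ) / Real.Gamma (l j - x + 1)) := by
    refine Finset.prod_congr rfl fun j hj => ?_
    rw [Function.update_of_ne (Finset.ne_of_mem_erase hj)]
  rw [hrest, Function.update_self, mul_right_comm]
  suffices key : (if i.castSucc < r then
      Real.Gamma (x - l r) / Real.Gamma (x - l r + 1 - θ)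
      else Real.Gamma (l r - x + θ) / Real.Gamma (l r - x + 1)) * (l r + θ - x) =
      (if i.castSucc < r then
        Real.Gamma (x - (l r + 1)) / Real.Gamma (x - (l r + 1) + 1 - θ)
        else Real.Gamma (l r + 1 - x + θ) / Real.Gamma (l r + 1 - x + 1)) * (l r + 1 - x) by
    rw [key, mul_right_comm]
  split_ifs with hr
  · have h1 := h'.1 r hr
    rw [Function.update_self] at h1
    have e1 : Real.Gamma (x - l r) = (x - l r - 1) * Real.Gamma (x - (l r + 1)) := by
      rw [gamma_sub_one (by linarith), sub_sub x]
    have e2 : Real.Gamma (x - l r + 1 - θ) =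
        (x - l r - θ) * Real.Gamma (x - (l r + 1) + 1 - θ) := by
      have : x - (l r + 1) + 1 - θ = x - l r - θ := by ring
      rw [this, ← Real.Gamma_add_one (by linarith)]; ring_nf
    have n1 : x - l r - θ ≠ 0 := by linarith
    have n2 := (Real.Gamma_pos_of_pos (show 0 < x - (l r + 1) + 1 - θ by linarith)).ne'
    rw [e1, e2]
    field_simp
    ring
  · have h1 := h.2 r (not_lt.mp hr)
    have e1 : Real.Gamma (l r + 1 - x + θ) = (l r - x + θ) * Real.Gamma (l r - x + θ) := by
      rw [← Real.Gamma_add_one (by linarith)]; ring_nf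
    have e2 : Real.Gamma (l r + 1 - x + 1) = (l r - x + 1) * Real.Gamma (l r - x + 1) := by
      rw [← Real.Gamma_add_one (by linarith)]; ring_nf
    have n1 : l r - x + 1 ≠ 0 := by linarith
    have n2 := (Real.Gamma_pos_of_pos (show 0 < l r - x + 1 by linarith)).ne'
    rw [e1, e2]
    field_simp
    ring

/-- The summands agree on the common range by `levelWeight_shift`, and each inserted product
vanishes on the part of its own range outside the other. -/
theorem branch_insert_shift {θ : ℝ} (hθ : 0 < θ) (N : ℕ) {k : ℕ} {a : Fin (k + 1) → ℤ}
    (ha : Antitone a) (r : Fin (k + 1)) (ha' : Antitone (Function.update a r (a r + 1))) :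
    (∑ b ∈ Fintype.piFinset fun i : Fin k => Finset.Icc (a i.succ) (a i.castSucc),
      (∏ i, levelWeight θ (shiftedCoord θ N a) i (shiftedPoint θ N i (b i)) *
        (shiftedCoord θ N a r + θ - shiftedPoint θ N i (b i))) *
      diffProd (fun i => shiftedPoint θ N i (b i))) =
    ∑ b ∈ Fintype.piFinset fun i : Fin k => Finset.Icc
        (Function.update a r (a r + 1) i.succ) (Function.update a r (a r + 1) i.castSucc),
      (∏ i, levelWeight θ (shiftedCoord θ N (Function.update a r (a r + 1))) i
        (shiftedPoint θ N i (b i)) *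
        (shiftedCoord θ N a r + 1 - shiftedPoint θ N i (b i))) *
      diffProd (fun i => shiftedPoint θ N i (b i)) := by
  set a' := Function.update a r (a r + 1) with ha'def
  have hsub (s : Fin k → Finset ℤ) (t : Fin k → Finset ℤ) (g : Fin k → ℤ → ℝ)
      (hst : ∀ i, s i ⊆ t i) (hg : ∀ i, ∀ b ∈ t i, b ∉ s i → g i b = 0) :
      ∑ b ∈ Fintype.piFinset t, (∏ i, g i (b i)) * diffProd (fun i => shiftedPoint θ N i (b i)) =
      ∑ b ∈ Fintype.piFinset s, (∏ i, g i (b i)) *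
        diffProd (fun i => shiftedPoint θ N i (b i)) := by
    symm
    refine Finset.sum_subset (Fintype.piFinset_subset _ _ hst) fun b hb hb' => ?_
    simp only [Fintype.mem_piFinset, not_forall] at hb hb'
    obtain ⟨i, hi⟩ := hb'
    rw [Finset.prod_eq_zero (Finset.mem_univ i) (hg i _ (hb i) hi), zero_mul]
  rw [hsub (fun i => Finset.Icc (a i.succ) (a i.castSucc) ∩ Finset.Icc (a' i.succ) (a' i.castSucc))
    _ (fun i b => levelWeight θ (shiftedCoord θ N a) i (shiftedPoint θ N i b) *
        (shiftedCoord θ N a r + θ - shiftedPoint θ N i b))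
    (fun i => Finset.inter_subset_left),
    hsub (fun i => Finset.Icc (a i.succ) (a i.castSucc) ∩ Finset.Icc (a' i.succ) (a' i.castSucc))
    _ (fun i b => levelWeight θ (shiftedCoord θ N a') i (shiftedPoint θ N i b) *
        (shiftedCoord θ N a r + 1 - shiftedPoint θ N i b))
    (fun i => Finset.inter_subset_right)]
  · refine Finset.sum_congr rfl fun b hb => ?_
    congr 1
    refine Finset.prod_congr rfl fun i _ => ?_
    simp only [Fintype.mem_piFinset, Finset.mem_inter] at hb
    have h2 := isBetween_shiftedPoint hθ N ha' (hb i).2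
    rw [ha'def, shiftedCoord_update] at h2 ⊢
    exact levelWeight_shift hθ r (isBetween_shiftedPoint hθ N ha (hb i).1) h2
  · intro i b hb hb'
    simp only [Finset.mem_inter, Finset.mem_Icc, not_and] at hb hb'
    refine mul_eq_zero_of_right _ ?_
    -- A point only in the new range sits at the raised upper end, x = l_r + 1.
    have hri : i.castSucc = r := by
      by_contra h
      have h1 : a' i.castSucc = a i.castSucc := by simp [ha'def, h]
      have h2 : a i.succ ≤ a' i.succ := by
        by_cases h : i.succ = r
        · subst h; simp [ha'def]
        · simp [ha'def, h]
      exact hb' ⟨by omega, by omega⟩ hb.1 hb.2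
    subst hri
    have h1 : a' i.castSucc = a i.castSucc + 1 := by simp [ha'def]
    have h2 : a' i.succ = a i.succ := by
      simp [ha'def, Fin.castSucc_lt_succ.ne']
    have : b = a i.castSucc + 1 := by
      by_contra h
      exact hb' ⟨by omega, by omega⟩ hb.1 hb.2
    subst this
    simp [shiftedCoord, shiftedPoint]; ring
  · intro i b hb hb'
    simp only [Finset.mem_inter, Finset.mem_Icc, not_and] at hb hb'
    refine mul_eq_zero_of_right _ ?_
    -- A point only in the old range sits at the former lower end, x = l_r + θ.
    have hri : i.succ = r := by
      by_contra h
      have h1 : a' i.succ = a i.succ := by simp [ha'def, h]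
      have h2 : a i.castSucc ≤ a' i.castSucc := by
        by_cases h : i.castSucc = r
        · subst h; simp [ha'def]
        · simp [ha'def, h]
      exact hb' hb (by omega) (by omega)
    subst hri
    have h1 : a' i.succ = a i.succ + 1 := by simp [ha'def]
    have h2 : a' i.castSucc = a i.castSucc := by
      simp [ha'def, Fin.castSucc_lt_succ.ne]
    have : b = a i.succ := by
      by_contra h
      exact hb' hb (by omega) (by omega)
    subst this
    simp [shiftedCoord, shiftedPoint]; ring

/-! ### The closed form under the same shift. -/

/-- The closed form of the branching sum, up to a constant. -/
noncomputable def gammaPairs (θ : ℝ) {k : ℕ} (l : Fin k → ℝ) : ℝ :=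
  ∏ i : Fin k, ∏ j ∈ Finset.Ioi i,
    Real.Gamma (l i - l j + θ) / Real.Gamma (l i - l j + 1 - θ)

/-- Spreads a product over j ≠ r across the pairs i < j, so that it can be compared with
`gammaPairs` pair by pair. -/
theorem prod_pairs_through {n : ℕ} (r : Fin n) (p : Fin n → ℝ) :
    (∏ i : Fin n, ∏ j ∈ Finset.Ioi i, if i = r then p j else if j = r then p i else 1) =
      ∏ j ∈ Finset.univ.erase r, p j := by
  have h (i : Fin n) : (∏ j ∈ Finset.Ioi i, if i = r then p j else if j = r then p i else 1) =
      (if i = r then ∏ j ∈ Finset.Ioi r, p j else 1) * if i ∈ Finset.Iio r then p i else 1 := by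
    rcases eq_or_ne i r with rfl | hi
    · simp
    · simp [hi, Finset.prod_ite_eq']
  have hs : Finset.univ.erase r = Finset.Ioi r ∪ Finset.Iio r := by
    ext j; simp [lt_or_lt_iff_ne, eq_comm]
  rw [Finset.prod_congr rfl fun i _ => h i, Finset.prod_mul_distrib, Finset.prod_ite_mem,
    Finset.univ_inter, hs, Finset.prod_union]
  · simp
  · rw [Finset.disjoint_left]
    intro j h1 h2
    exact absurd (Finset.mem_Ioi.mp h1) (Finset.mem_Iio.mp h2).asymm

theorem shiftedCoord_sub_ge {θ : ℝ} (hθ : 0 < θ) (N : ℕ) {k : ℕ} {a : Fin k → ℤ}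
    (ha : Antitone a) {i j : Fin k} (hij : i < j) :
    θ ≤ shiftedCoord θ N a i - shiftedCoord θ N a j := by
  have h1 : (a j : ℝ) ≤ a i := by exact_mod_cast ha hij.le
  have h2 : ((i : ℕ) : ℝ) + 1 ≤ (j : ℕ) := by
    have : (i : ℕ) < j := hij
    exact_mod_cast this
  simp only [shiftedCoord]
  nlinarith

theorem gammaPairs_shift {θ : ℝ} (hθ : 0 < θ) (N : ℕ) {k : ℕ} {a : Fin k → ℤ}
    (ha : Antitone a) (r : Fin k) (ha' : Antitone (Function.update a r (a r + 1))) :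
    gammaPairs θ (shiftedCoord θ N (Function.update a r (a r + 1))) *
        ∏ j ∈ Finset.univ.erase r, (shiftedCoord θ N a r + 1 - (shiftedCoord θ N a j + θ)) =
      gammaPairs θ (shiftedCoord θ N a) *
        ∏ j ∈ Finset.univ.erase r, (shiftedCoord θ N a r + θ - shiftedCoord θ N a j) := by
  rw [← prod_pairs_through, ← prod_pairs_through]
  simp only [gammaPairs, ← Finset.prod_mul_distrib]
  refine Finset.prod_congr rfl fun i _ => Finset.prod_congr rfl fun j hj => ?_
  rw [Finset.mem_Ioi] at hj
  have h1 := shiftedCoord_sub_ge hθ N ha hj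
  have h2 := shiftedCoord_sub_ge hθ N ha' hj
  rw [shiftedCoord_update] at h2 ⊢
  generalize shiftedCoord θ N a = l at *
  by_cases hi : i = r
  · subst hi
    rw [Function.update_self, Function.update_of_ne hj.ne', if_pos rfl, if_pos rfl]
    have e1 : Real.Gamma (l i + 1 - l j + θ) = (l i + θ - l j) * Real.Gamma (l i - l j + θ) := by
      have : l i + θ - l j = l i - l j + θ := by ring
      rw [this, ← Real.Gamma_add_one (by linarith)]; ring_nf
    have e2 : Real.Gamma (l i + 1 - l j + 1 - θ) =
        (l i + 1 - (l j + θ)) * Real.Gamma (l i - l j + 1 - θ) := by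
      have : l i + 1 - (l j + θ) = l i - l j + 1 - θ := by ring
      rw [this, ← Real.Gamma_add_one (by linarith)]; ring_nf
    have n1 : l i + 1 - (l j + θ) ≠ 0 := by linarith
    have n2 := (Real.Gamma_pos_of_pos (show 0 < l i - l j + 1 - θ by linarith)).ne'
    rw [e1, e2]
    field_simp
  by_cases hjr : j = r
  · subst hjr
    rw [Function.update_self, Function.update_of_ne hi] at h2 ⊢
    rw [if_neg hi, if_neg hi, if_pos rfl, if_pos rfl]
    have e1 : Real.Gamma (l i - l j + θ) =
        -(l j + 1 - (l i + θ)) * Real.Gamma (l i - (l j + 1) + θ) := by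
      have : -(l j + 1 - (l i + θ)) = l i - (l j + 1) + θ := by ring
      rw [this, ← Real.Gamma_add_one (by linarith)]; ring_nf
    have e2 : Real.Gamma (l i - l j + 1 - θ) =
        -(l j + θ - l i) * Real.Gamma (l i - (l j + 1) + 1 - θ) := by
      have : -(l j + θ - l i) = l i - (l j + 1) + 1 - θ := by ring
      rw [this, ← Real.Gamma_add_one (by linarith)]; ring_nf
    have n1 : l j + θ - l i ≠ 0 := by linarith
    have n2 := (Real.Gamma_pos_of_pos (show 0 < l i - (l j + 1) + 1 - θ by linarith)).ne'
    rw [e1, e2]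
    field_simp
  · simp [hi, hjr]

/-- For j < r the factor is negative because the shifted tuple is still antitone; for j > r it is at
least 1. -/
theorem shift_factor_ne_zero {θ : ℝ} (hθ : 0 < θ) (N : ℕ) {k : ℕ} {a : Fin k → ℤ}
    (ha : Antitone a) (r : Fin k) (ha' : Antitone (Function.update a r (a r + 1))) :
    ∏ j ∈ Finset.univ.erase r,
      (shiftedCoord θ N a r + 1 - (shiftedCoord θ N a j + θ)) ≠ 0 := by
  refine Finset.prod_ne_zero_iff.mpr fun j hj => ?_
  rcases lt_or_gt_of_ne (Finset.ne_of_mem_erase hj) with h | h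
  · have h2 := shiftedCoord_sub_ge hθ N ha' h
    rw [shiftedCoord_update, Function.update_self, Function.update_of_ne h.ne] at h2
    linarith
  · have h2 := shiftedCoord_sub_ge hθ N ha h
    linarith

theorem branchSum_shift {θ : ℝ} (hθ : 0 < θ) (N : ℕ) {k : ℕ} {a : Fin (k + 1) → ℤ}
    (ha : Antitone a) (r : Fin (k + 1)) (ha' : Antitone (Function.update a r (a r + 1))) :
    branchSum θ N (Function.update a r (a r + 1)) *
        ∏ j ∈ Finset.univ.erase r, (shiftedCoord θ N a r + 1 - (shiftedCoord θ N a j + θ)) =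
      branchSum θ N a *
        ∏ j ∈ Finset.univ.erase r, (shiftedCoord θ N a r + θ - shiftedCoord θ N a j) := by
  -- Each c is a root of one of the two products in R: c = l_r + θ kills the θ-shifted one for `a`,
  -- and c = l_r + 1 the unshifted one for the raised tuple. A common factor θ is left from j = r.
  have h1 := branchSum_insert hθ N ha (shiftedCoord θ N a r + θ)
  have h2 := branchSum_insert hθ N ha' (shiftedCoord θ N a r + 1)
  rw [← branch_insert_shift hθ N ha r ha', h1, shiftedCoord_update,
    ← Finset.mul_prod_erase _ (fun j => shiftedCoord θ N a r + θ - shiftedCoord θ N a j)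
      (Finset.mem_univ r),
    Finset.prod_eq_zero (f := fun j => shiftedCoord θ N a r + θ - (shiftedCoord θ N a j + θ))
      (Finset.mem_univ r) (sub_self _),
    Finset.prod_eq_zero (f := fun j => shiftedCoord θ N a r + 1 -
      Function.update (shiftedCoord θ N a) r (shiftedCoord θ N a r + 1) j)
      (Finset.mem_univ r) (by simp),
    ← Finset.mul_prod_erase _ (fun j => shiftedCoord θ N a r + 1 -
      (Function.update (shiftedCoord θ N a) r (shiftedCoord θ N a r + 1) j + θ))
      (Finset.mem_univ r)] at h2
  have h3 : ∏ j ∈ Finset.univ.erase r, (shiftedCoord θ N a r + 1 -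
      (Function.update (shiftedCoord θ N a) r (shiftedCoord θ N a r + 1) j + θ)) =
      ∏ j ∈ Finset.univ.erase r, (shiftedCoord θ N a r + 1 - (shiftedCoord θ N a j + θ)) :=
    Finset.prod_congr rfl fun j hj => by rw [Function.update_of_ne (Finset.ne_of_mem_erase hj)]
  rw [h3, Function.update_self] at h2
  apply mul_left_cancel₀ hθ.ne'
  linear_combination -h2

/-! ### Constant signatures: the base case. -/

/-- The product of `g (j - i)` over `i < j < n`. -/
def triProd (n : ℕ) (g : ℕ → ℝ) : ℝ :=
  ∏ i : Fin n, ∏ j ∈ Finset.Ioi i, g ((j : ℕ) - i)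

theorem triProd_succ (n : ℕ) (g : ℕ → ℝ) :
    triProd (n + 1) g = (∏ d ∈ Finset.range n, g (d + 1)) * triProd n g := by
  rw [triProd, Fin.prod_univ_succ, Fin.prod_Ioi_zero, ← Fin.prod_univ_eq_prod_range]
  simp only [Fin.prod_Ioi_succ, Fin.val_succ, Fin.val_zero, Nat.sub_zero, Nat.add_sub_add_right]
  rfl

/-- Its left side is the factor gained by the left side of `triProd_gamma_identity` when k grows by
1. -/
theorem prod_gamma_level {θ : ℝ} (hθ : 0 < θ) (k : ℕ) :
    (∏ d ∈ Finset.range k, ((d + 1 : ℕ) * θ)) * ∏ d ∈ Finset.range (k + 1),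
      (Real.Gamma ((d + 1 : ℕ) * θ) ^ 2 / Real.Gamma (d * θ + 1)) =
    Real.Gamma ((k + 1 : ℕ) * θ) * ∏ d ∈ Finset.range (k + 1), Real.Gamma ((d + 1 : ℕ) * θ) := by
  induction k with
  | zero => simp [sq]
  | succ k ih =>
    rw [Finset.prod_range_succ, Finset.prod_range_succ (n := k + 1),
      Finset.prod_range_succ (n := k + 1)]
    have hp : 0 < ((k + 1 : ℕ) : ℝ) * θ := by positivity
    have hg := (Real.Gamma_pos_of_pos hp).ne'
    rw [Real.Gamma_add_one hp.ne']
    field_simp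
    field_simp at ih
    linear_combination ih

theorem triProd_gamma_identity {θ : ℝ} (hθ : 0 < θ) (k : ℕ) :
    triProd k (fun d => d * θ) * triProd (k + 1) (fun d =>
      Real.Gamma (d * θ) ^ 2 / Real.Gamma ((d - 1 : ℕ) * θ + 1)) =
    Real.Gamma θ ^ (k + 1) / Real.Gamma ((k + 1 : ℕ) * θ) *
      triProd (k + 1) (fun d => Real.Gamma ((d + 1 : ℕ) * θ)) := by
  induction k with
  | zero =>
    have hg := (Real.Gamma_pos_of_pos hθ).ne'
    simp [triProd, hg]
  | succ k ih =>
    rw [triProd_succ, triProd_succ (k + 1), triProd_succ (k + 1)]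
    simp only [Nat.add_sub_cancel]
    have h := prod_gamma_level hθ k
    have hg1 := (Real.Gamma_pos_of_pos (show 0 < ((k + 1 : ℕ) : ℝ) * θ by positivity)).ne'
    have hg2 := (Real.Gamma_pos_of_pos (show 0 < ((k + 1 + 1 : ℕ) : ℝ) * θ by positivity)).ne'
    have hs : Real.Gamma θ * ∏ d ∈ Finset.range (k + 1), Real.Gamma ((d + 1 + 1 : ℕ) * θ) =
        (∏ d ∈ Finset.range (k + 1), Real.Gamma ((d + 1 : ℕ) * θ)) *
          Real.Gamma ((k + 1 + 1 : ℕ) * θ) := by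
      have e1 := Finset.prod_range_succ (fun d : ℕ => Real.Gamma ((d + 1 : ℕ) * θ)) (k + 1)
      have e2 := Finset.prod_range_succ' (fun d : ℕ => Real.Gamma ((d + 1 : ℕ) * θ)) (k + 1)
      rw [← e1, e2, zero_add, Nat.cast_one, one_mul, mul_comm]
    calc _ = ((∏ d ∈ Finset.range k, ((d + 1 : ℕ) * θ)) * ∏ d ∈ Finset.range (k + 1),
          (Real.Gamma ((d + 1 : ℕ) * θ) ^ 2 / Real.Gamma (d * θ + 1))) *
          (triProd k (fun d => d * θ) * triProd (k + 1) (fun d =>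
            Real.Gamma (d * θ) ^ 2 / Real.Gamma ((d - 1 : ℕ) * θ + 1))) := by ring
      _ = Real.Gamma ((k + 1 : ℕ) * θ) *
          (∏ d ∈ Finset.range (k + 1), Real.Gamma ((d + 1 : ℕ) * θ)) *
          (Real.Gamma θ ^ (k + 1) / Real.Gamma ((k + 1 : ℕ) * θ) *
            triProd (k + 1) (fun d => Real.Gamma ((d + 1 : ℕ) * θ))) := by rw [h, ih]
      _ = Real.Gamma θ ^ (k + 1) * ((∏ d ∈ Finset.range (k + 1), Real.Gamma ((d + 1 : ℕ) * θ)) *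
          Real.Gamma ((k + 1 + 1 : ℕ) * θ)) / Real.Gamma ((k + 1 + 1 : ℕ) * θ) *
            triProd (k + 1) (fun d => Real.Gamma ((d + 1 : ℕ) * θ)) := by
        rw [mul_div_assoc, mul_div_assoc, div_self hg2]
        field_simp
      _ = _ := by rw [← hs, pow_succ (Real.Gamma θ) (k + 1)]; ring

/-- The indices j > i and the indices j ≤ i each enumerate all pairs in k + 1 points, the latter as
j < i + 1. -/
theorem prod_levels_eq_sq (k : ℕ) (u : ℕ → ℝ) :
    (∏ i : Fin k, ∏ j : Fin (k + 1), if i.castSucc < j then u ((j : ℕ) - i)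
      else u ((i : ℕ) - j + 1)) = triProd (k + 1) u * triProd (k + 1) u := by
  have h (i : Fin k) : (∏ j : Fin (k + 1), if i.castSucc < j then u ((j : ℕ) - i)
      else u ((i : ℕ) - j + 1)) = (∏ j ∈ Finset.Ioi i.castSucc, u ((j : ℕ) - i)) *
      ∏ j : Fin (k + 1), if j ≤ i.castSucc then u ((i : ℕ) - j + 1) else 1 := by
    rw [← Finset.filter_lt_eq_Ioi, Finset.prod_filter, ← Finset.prod_mul_distrib]
    refine Finset.prod_congr rfl fun j _ => ?_
    rcases lt_or_ge i.castSucc j with h | h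
    · simp [h, h.not_ge]
    · simp [h, h.not_gt]
  rw [Finset.prod_congr rfl fun i _ => h i, Finset.prod_mul_distrib]
  congr 1
  · rw [triProd, Fin.prod_univ_castSucc]
    simp [← Fin.top_eq_last]
  · rw [Finset.prod_comm, triProd]
    refine Finset.prod_congr rfl fun j _ => ?_
    rw [← Finset.filter_lt_eq_Ioi, Finset.prod_filter, Fin.prod_univ_succ]
    simp only [not_lt_zero, if_false, one_mul]
    refine Finset.prod_congr rfl fun i _ => ?_
    by_cases hji : j ≤ i.castSucc
    · have h1 : j < i.succ := Fin.le_castSucc_iff.mp hji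
      have h2 : (j : ℕ) ≤ i := hji
      rw [if_pos hji, if_pos h1, Fin.val_succ]
      congr 1
      omega
    · have h1 : ¬ j < i.succ := fun h => hji (Fin.le_castSucc_iff.mpr h)
      rw [if_neg hji, if_neg h1]

theorem branchSum_const {θ : ℝ} (hθ : 0 < θ) (N : ℕ) (k : ℕ) (t : ℤ) :
    branchSum θ N (fun _ : Fin (k + 1) => t) =
      Real.Gamma θ ^ (k + 1) / Real.Gamma ((k + 1 : ℕ) * θ) *
        gammaPairs θ (shiftedCoord θ N (fun _ : Fin (k + 1) => t)) := by
  -- Every interval is a point, so the sum has one term, whose Gamma arguments are multiples of θ,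
  -- or such multiples plus 1.
  have hset : (Fintype.piFinset fun _ : Fin k => Finset.Icc t t) = {fun _ => t} := by
    simp
  rw [branchSum, hset, Finset.sum_singleton]
  have hV : diffProd (fun i : Fin k => shiftedPoint θ N i t) = triProd k (fun d => d * θ) := by
    refine Finset.prod_congr rfl fun i _ => Finset.prod_congr rfl fun j hj => ?_
    have : (i : ℕ) ≤ j := (Finset.mem_Ioi.mp hj).le
    simp only [shiftedPoint, Nat.cast_sub this]
    ring
  have hw : ∏ i, levelWeight θ (shiftedCoord θ N (fun _ : Fin (k + 1) => t)) i
      (shiftedPoint θ N i t) = triProd (k + 1)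
        (fun d => Real.Gamma (d * θ) / Real.Gamma ((d - 1 : ℕ) * θ + 1)) * triProd (k + 1)
        (fun d => Real.Gamma (d * θ) / Real.Gamma ((d - 1 : ℕ) * θ + 1)) := by
    rw [← prod_levels_eq_sq]
    refine Finset.prod_congr rfl fun i _ => Finset.prod_congr rfl fun j _ => ?_
    split_ifs with h
    · have h' : (i : ℕ) < j := h
      simp only [shiftedPoint, shiftedCoord]
      rw [Nat.cast_sub (by omega : 1 ≤ (j : ℕ) - i), Nat.cast_sub h'.le]
      congr 2 <;> push_cast <;> ring
    · have h' : (j : ℕ) ≤ i := not_lt.mp h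
      simp only [shiftedPoint, shiftedCoord, Nat.add_sub_cancel]
      push_cast [Nat.cast_sub h']
      congr 2 <;> ring
  have hR : gammaPairs θ (shiftedCoord θ N (fun _ : Fin (k + 1) => t)) =
      triProd (k + 1) (fun d => Real.Gamma ((d + 1 : ℕ) * θ) /
        Real.Gamma ((d - 1 : ℕ) * θ + 1)) := by
    refine Finset.prod_congr rfl fun i _ => Finset.prod_congr rfl fun j hj => ?_
    rw [Finset.mem_Ioi] at hj
    have h' : (i : ℕ) < j := hj
    simp only [shiftedCoord]
    rw [Nat.cast_sub (by omega : 1 ≤ (j : ℕ) - i), Nat.cast_add, Nat.cast_sub h'.le]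
    congr 2 <;> push_cast <;> ring
  have hmul (n : ℕ) (g h : ℕ → ℝ) : triProd n (fun d => g d * h d) = triProd n g * triProd n h := by
    simp only [triProd, Finset.prod_mul_distrib]
  have key := triProd_gamma_identity hθ k
  rw [hV, hw, hR]
  simp only [div_eq_mul_inv, hmul, sq] at key ⊢
  linear_combination (triProd (k + 1) fun d => (Real.Gamma ((d - 1 : ℕ) * θ + 1))⁻¹) * key

/-! ### Evaluation of the branching sum. -/

/-- A discrete Dixon–Anderson evaluation. -/
theorem branchSum_eq {θ : ℝ} (hθ : 0 < θ) (N : ℕ) {k : ℕ} {a : Fin (k + 1) → ℤ}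
    (ha : Antitone a) :
    branchSum θ N a = Real.Gamma θ ^ (k + 1) / Real.Gamma ((k + 1 : ℕ) * θ) *
      gammaPairs θ (shiftedCoord θ N a) := by
  obtain ⟨n, hn⟩ : ∃ n : ℕ, ∑ i, (a i - a (Fin.last k)) = n :=
    Int.eq_ofNat_of_zero_le (Finset.sum_nonneg fun i _ => sub_nonneg.mpr (ha (Fin.le_last i)))
  induction n generalizing a with
  | zero =>
    have h0 : ∀ i, a i = a (Fin.last k) := fun i => by
      have := (Finset.sum_eq_zero_iff_of_nonneg
        fun i _ => sub_nonneg.mpr (ha (Fin.le_last i))).mp hn i (Finset.mem_univ i)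
      omega
    rw [show a = fun _ => a (Fin.last k) from funext h0]
    exact branchSum_const hθ N k _
  | succ n ih =>
    -- The last index whose part exceeds the final part: all later parts equal the final one, so
    -- lowering this part by 1 keeps the tuple antitone.
    obtain ⟨r, hr, hmax⟩ : ∃ r, a r ≠ a (Fin.last k) ∧
        ∀ j, r < j → a j = a (Fin.last k) := by
      have hne : (Finset.univ.filter fun i => a i ≠ a (Fin.last k)).Nonempty := by
        by_contra h
        rw [Finset.not_nonempty_iff_eq_empty, Finset.filter_eq_empty_iff] at h
        rw [Finset.sum_eq_zero fun i _ => by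
          simpa [sub_eq_zero] using h (Finset.mem_univ i)] at hn
        push_cast at hn
        omega
      refine ⟨_, (Finset.mem_filter.mp (Finset.max'_mem _ hne)).2, fun j hj => ?_⟩
      by_contra h
      exact absurd (Finset.le_max' _ j (Finset.mem_filter.mpr ⟨Finset.mem_univ j, h⟩)) hj.not_ge
    have hrl : a (Fin.last k) < a r := lt_of_le_of_ne (ha (Fin.le_last r)) hr.symm
    have hlast : Fin.last k ≠ r := fun h => hr (by rw [h])
    set c := Function.update a r (a r - 1) with hc
    have hca : Antitone c := by
      intro i j hij
      rcases eq_or_ne i r with rfl | hi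
      · rcases eq_or_ne j i with rfl | hj
        · exact le_rfl
        · rw [hc, Function.update_self, Function.update_of_ne hj,
            hmax j (lt_of_le_of_ne hij hj.symm)]
          omega
      · rw [hc, Function.update_of_ne hi]
        have := ha hij
        rcases eq_or_ne j r with rfl | hj
        · rw [Function.update_self]; omega
        · rwa [Function.update_of_ne hj]
    have hback : Function.update c r (c r + 1) = a := by simp [hc]
    have hsum : ∑ i, (c i - c (Fin.last k)) = n := by
      rw [← Finset.add_sum_erase _ _ (Finset.mem_univ r)] at hn ⊢
      have : ∑ i ∈ Finset.univ.erase r, (c i - c (Fin.last k)) =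
          ∑ i ∈ Finset.univ.erase r, (a i - a (Fin.last k)) :=
        Finset.sum_congr rfl fun i hi => by
          rw [hc, Function.update_of_ne (Finset.ne_of_mem_erase hi), Function.update_of_ne hlast]
      rw [this, hc, Function.update_self, Function.update_of_ne hlast]
      push_cast at hn
      linarith
    have h1 := branchSum_shift hθ N hca r (by rw [hback]; exact ha)
    have h2 := gammaPairs_shift hθ N hca r (by rw [hback]; exact ha)
    have h3 := shift_factor_ne_zero hθ N hca r (by rw [hback]; exact ha)
    rw [hback] at h1 h2
    apply mul_right_cancel₀ h3
    rw [h1, ih hca hsum, mul_assoc, mul_assoc, h2]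

/-! ### Interlacing, positivity and the Jack branching rule. -/

theorem shiftedCoord_injective (θ : ℝ) (N k : ℕ) :
    Function.Injective (shiftedCoord θ N : (Fin k → ℤ) → Fin k → ℝ) := by
  intro a b h
  ext i
  have := congrFun h i
  simpa [shiftedCoord] using this

theorem interlaces_iff {θ : ℝ} {N k : ℕ} {m : Fin k → ℝ} {a : Fin (k + 1) → ℤ} :
    Interlaces θ N m (shiftedCoord θ N a) ↔
      ∃ b ∈ Fintype.piFinset fun i : Fin k => Finset.Icc (a i.succ) (a i.castSucc),
        shiftedCoord θ N b = m := by
  simp only [Fintype.mem_piFinset, Finset.mem_Icc]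
  constructor
  · rintro ⟨b, a', hm, ha, h⟩
    obtain rfl := shiftedCoord_injective θ N _ ha
    exact ⟨b, h, hm.symm⟩
  · rintro ⟨b, h, hm⟩
    exact ⟨b, a, hm.symm, rfl, h⟩

theorem antitone_of_interlacing {k : ℕ} {a : Fin (k + 1) → ℤ} (ha : Antitone a) {b : Fin k → ℤ}
    (hb : b ∈ Fintype.piFinset fun i : Fin k => Finset.Icc (a i.succ) (a i.castSucc)) :
    Antitone b := by
  simp only [Fintype.mem_piFinset, Finset.mem_Icc] at hb
  intro i j hij
  rcases eq_or_lt_of_le hij with rfl | h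
  · exact le_rfl
  · exact (hb j).2.trans ((ha (Fin.succ_le_castSucc_iff.mpr h)).trans (hb i).1)

theorem levelWeight_eq_mul (θ : ℝ) {k : ℕ} (l : Fin (k + 1) → ℝ) (i : Fin k) (x : ℝ) :
    levelWeight θ l i x =
      (∏ j ∈ Finset.Ioi i.castSucc, Real.Gamma (x - l j) / Real.Gamma (x - l j + 1 - θ)) *
      ∏ j : Fin k, if j ≤ i then
        Real.Gamma (l j.castSucc - x + θ) / Real.Gamma (l j.castSucc - x + 1) else 1 := by
  have h : (∏ j : Fin k, if j ≤ i then
        Real.Gamma (l j.castSucc - x + θ) / Real.Gamma (l j.castSucc - x + 1) else 1) =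
      ∏ j : Fin (k + 1), if j ≤ i.castSucc then
        Real.Gamma (l j - x + θ) / Real.Gamma (l j - x + 1) else 1 := by
    rw [Fin.prod_univ_castSucc, if_neg (Fin.castSucc_lt_last i).not_ge, mul_one]
    simp only [Fin.castSucc_le_castSucc_iff]
  rw [h, ← Finset.filter_lt_eq_Ioi, Finset.prod_filter, ← Finset.prod_mul_distrib, levelWeight]
  refine Finset.prod_congr rfl fun j _ => ?_
  rcases lt_or_ge i.castSucc j with h | h
  · simp [h, h.not_ge]
  · simp [h, h.not_gt]

theorem prod_levelWeight (θ : ℝ) {k : ℕ} (l : Fin (k + 1) → ℝ) (m : Fin k → ℝ) :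
    ∏ i, levelWeight θ l i (m i) =
      (∏ i : Fin k, ∏ j ∈ Finset.Ioi i.castSucc,
        Real.Gamma (m i - l j) / Real.Gamma (m i - l j + 1 - θ)) *
      ∏ i : Fin k, ∏ j ∈ Finset.Ici i,
        Real.Gamma (l i.castSucc - m j + θ) / Real.Gamma (l i.castSucc - m j + 1) := by
  simp only [levelWeight_eq_mul, Finset.prod_mul_distrib]
  congr 1
  rw [Finset.prod_comm]
  refine Finset.prod_congr rfl fun i _ => ?_
  rw [← Finset.filter_le_eq_Ici, Finset.prod_filter]

theorem levelWeight_pos {θ : ℝ} (hθ : 0 < θ) {k : ℕ} {l : Fin (k + 1) → ℝ} {i : Fin k} {x : ℝ}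
    (h : IsBetween θ l i x) : 0 < levelWeight θ l i x := by
  refine Finset.prod_pos fun j _ => ?_
  split_ifs with hj
  · have := h.1 j hj
    exact div_pos (Real.Gamma_pos_of_pos (by linarith)) (Real.Gamma_pos_of_pos (by linarith))
  · have := h.2 j (not_lt.mp hj)
    exact div_pos (Real.Gamma_pos_of_pos (by linarith)) (Real.Gamma_pos_of_pos (by linarith))

theorem jackI_eq (θ : ℝ) {k : ℕ} (l : Fin (k + 1) → ℝ) (m : Fin k → ℝ) :
    jackI θ l m = (Real.Gamma θ ^ k)⁻¹ *
      (∏ i : Fin (k + 1), ∏ j ∈ Finset.Ioi i,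
        Real.Gamma (l i - l j + 1 - θ) / Real.Gamma (l i - l j)) *
      (∏ i : Fin k, ∏ j ∈ Finset.Ioi i,
        Real.Gamma (m i - m j + 1) / Real.Gamma (m i - m j + θ)) *
      ∏ i, levelWeight θ l i (m i) := by
  rw [prod_levelWeight, jackI, ← mul_assoc]

theorem jackI_nonneg {θ : ℝ} (hθ : 0 < θ) {N k : ℕ} {l : Fin (k + 1) → ℝ} {m : Fin k → ℝ}
    (hl : l ∈ stateW θ N (k + 1)) (h : Interlaces θ N m l) : 0 ≤ jackI θ l m := by
  obtain ⟨a, ha, rfl⟩ := hl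
  obtain ⟨b, hb, rfl⟩ := interlaces_iff.mp h
  have hb' := antitone_of_interlacing ha hb
  rw [jackI_eq]
  refine mul_nonneg (mul_nonneg (mul_nonneg ?_ ?_) ?_) ?_
  · exact inv_nonneg.mpr (pow_nonneg (Real.Gamma_pos_of_pos hθ).le _)
  · refine Finset.prod_nonneg fun i _ => Finset.prod_nonneg fun j hj => ?_
    have := shiftedCoord_sub_ge hθ N ha (Finset.mem_Ioi.mp hj)
    exact div_nonneg (Real.Gamma_pos_of_pos (by linarith)).le
      (Real.Gamma_pos_of_pos (by linarith)).le
  · refine Finset.prod_nonneg fun i _ => Finset.prod_nonneg fun j hj => ?_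
    have := shiftedCoord_sub_ge hθ N hb' (Finset.mem_Ioi.mp hj)
    exact div_nonneg (Real.Gamma_pos_of_pos (by linarith)).le
      (Real.Gamma_pos_of_pos (by linarith)).le
  · exact Finset.prod_nonneg fun i _ => (levelWeight_pos hθ
      (isBetween_shiftedPoint hθ N ha (Fintype.mem_piFinset.mp hb i))).le

theorem bottomFactor_nonneg {θ : ℝ} (hθ : 0 < θ) {N k : ℕ} {m : Fin k → ℝ}
    (hm : m ∈ stateW θ N k) : 0 ≤ bottomFactor θ m := by
  obtain ⟨b, hb, rfl⟩ := hm
  refine Finset.prod_nonneg fun i _ => Finset.prod_nonneg fun j hj => ?_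
  have := shiftedCoord_sub_ge hθ N hb (Finset.mem_Ioi.mp hj)
  exact div_nonneg (Real.Gamma_pos_of_pos (by linarith)).le
    (Real.Gamma_pos_of_pos (by linarith)).le

theorem topFactor_nonneg {θ : ℝ} (hθ : 0 < θ) {w : ℝ → ℝ} (hw : ∀ x, 0 ≤ w x) {N k : ℕ}
    {l : Fin k → ℝ} (hl : l ∈ stateW θ N k) : 0 ≤ topFactor θ w l := by
  obtain ⟨b, hb, rfl⟩ := hl
  refine mul_nonneg (Finset.prod_nonneg fun i _ => Finset.prod_nonneg fun j hj => ?_)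
    (Finset.prod_nonneg fun i _ => hw _)
  have := shiftedCoord_sub_ge hθ N hb (Finset.mem_Ioi.mp hj)
  exact div_nonneg (Real.Gamma_pos_of_pos (by linarith)).le
    (Real.Gamma_pos_of_pos (by linarith)).le

theorem betaWeight_eq (θ : ℝ) (w : ℝ → ℝ) {k : ℕ} (l : Fin k → ℝ) :
    betaWeight θ w l = topFactor θ w l * bottomFactor θ l := by
  rw [betaWeight, topFactor, bottomFactor, mul_right_comm]
  congr 1
  simp only [← Finset.prod_mul_distrib]
  refine Finset.prod_congr rfl fun i _ => Finset.prod_congr rfl fun j _ => ?_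
  rw [div_mul_div_comm, mul_comm (Real.Gamma (l i - l j)) _]

/-- For each pair of `m`, Γ(y+1)/Γ(y+θ) · Γ(y+θ)/Γ(y) = y, which yields the Vandermonde factor of
`branchSum`. -/
theorem jackI_mul_bottomFactor {θ : ℝ} (hθ : 0 < θ) {N k : ℕ} (l : Fin (k + 1) → ℝ)
    {m : Fin k → ℝ} (hm : m ∈ stateW θ N k) :
    jackI θ l m * bottomFactor θ m = (Real.Gamma θ ^ k)⁻¹ *
      (∏ i : Fin (k + 1), ∏ j ∈ Finset.Ioi i,
        Real.Gamma (l i - l j + 1 - θ) / Real.Gamma (l i - l j)) *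
      ((∏ i, levelWeight θ l i (m i)) * diffProd m) := by
  have h : (∏ i : Fin k, ∏ j ∈ Finset.Ioi i,
      Real.Gamma (m i - m j + 1) / Real.Gamma (m i - m j + θ)) * bottomFactor θ m =
      diffProd m := by
    obtain ⟨b, hb, rfl⟩ := hm
    simp only [bottomFactor, diffProd, ← Finset.prod_mul_distrib]
    refine Finset.prod_congr rfl fun i _ => Finset.prod_congr rfl fun j hj => ?_
    have := shiftedCoord_sub_ge hθ N hb (Finset.mem_Ioi.mp hj)
    generalize shiftedCoord θ N b i - shiftedCoord θ N b j = y at *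
    have h1 := (Real.Gamma_pos_of_pos (show 0 < y by linarith)).ne'
    have h2 := (Real.Gamma_pos_of_pos (show 0 < y + θ by linarith)).ne'
    rw [Real.Gamma_add_one (by linarith)]
    field_simp
  rw [jackI_eq, ← h]
  ring

/-- The branching rule for the value of the Jack function at `(1, …, 1)`. -/
theorem sum_jackI_mul_bottomFactor {θ : ℝ} (hθ : 0 < θ) (N : ℕ) {k : ℕ} {a : Fin (k + 1) → ℤ}
    (ha : Antitone a) :
    ∑ b ∈ Fintype.piFinset fun i : Fin k => Finset.Icc (a i.succ) (a i.castSucc),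
      jackI θ (shiftedCoord θ N a) (shiftedCoord θ N b) * bottomFactor θ (shiftedCoord θ N b) =
    Real.Gamma θ / Real.Gamma ((k + 1 : ℕ) * θ) * bottomFactor θ (shiftedCoord θ N a) := by
  have h1 := Finset.sum_congr rfl fun b hb => jackI_mul_bottomFactor hθ (N := N)
    (shiftedCoord θ N a) ⟨b, antitone_of_interlacing ha hb, rfl⟩
  have h2 : (∏ i : Fin (k + 1), ∏ j ∈ Finset.Ioi i,
      Real.Gamma (shiftedCoord θ N a i - shiftedCoord θ N a j + 1 - θ) /
        Real.Gamma (shiftedCoord θ N a i - shiftedCoord θ N a j)) *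
      gammaPairs θ (shiftedCoord θ N a) = bottomFactor θ (shiftedCoord θ N a) := by
    simp only [bottomFactor, gammaPairs, ← Finset.prod_mul_distrib]
    refine Finset.prod_congr rfl fun i _ => Finset.prod_congr rfl fun j hj => ?_
    have := shiftedCoord_sub_ge hθ N ha (Finset.mem_Ioi.mp hj)
    have h1 := (Real.Gamma_pos_of_pos (show 0 < shiftedCoord θ N a i - shiftedCoord θ N a j +
      1 - θ by linarith)).ne'
    field_simp
  rw [h1, ← Finset.mul_sum]
  have h3 := branchSum_eq hθ N ha
  unfold branchSum at h3
  have hg := (Real.Gamma_pos_of_pos hθ).ne'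
  rw [← h2]
  calc _ = _ * (Real.Gamma θ ^ (k + 1) / Real.Gamma ((k + 1 : ℕ) * θ) *
      gammaPairs θ (shiftedCoord θ N a)) := by rw [← h3]; rfl
    _ = _ := by
      generalize (∏ i : Fin (k + 1), ∏ j ∈ Finset.Ioi i, _ : ℝ) = D
      field_simp
      ring

theorem tsum_jackI_mul_bottomFactor {θ : ℝ} (hθ : 0 < θ) {N k : ℕ} {l : Fin (k + 1) → ℝ}
    (hl : l ∈ stateW θ N (k + 1)) [DecidablePred fun m : Fin k → ℝ => Interlaces θ N m l] :
    (∑' m : Fin k → ℝ, if Interlaces θ N m l then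
      ENNReal.ofReal (jackI θ l m * bottomFactor θ m) else 0) =
    ENNReal.ofReal (Real.Gamma θ / Real.Gamma ((k + 1 : ℕ) * θ) * bottomFactor θ l) := by
  obtain ⟨a, ha, rfl⟩ := hl
  rw [← sum_jackI_mul_bottomFactor hθ N ha, ENNReal.ofReal_sum_of_nonneg]
  · rw [tsum_eq_sum (s := (Fintype.piFinset fun i : Fin k =>
      Finset.Icc (a i.succ) (a i.castSucc)).map ⟨_, shiftedCoord_injective θ N k⟩), Finset.sum_map]
    · exact Finset.sum_congr rfl fun b hb => if_pos (interlaces_iff.mpr ⟨b, hb, rfl⟩)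
    · intro m hm
      refine if_neg fun h => hm ?_
      simpa using interlaces_iff.mp h
  · intro b hb
    exact mul_nonneg (jackI_nonneg hθ ⟨a, ha, rfl⟩ (interlaces_iff.mpr ⟨b, hb, rfl⟩))
      (bottomFactor_nonneg hθ ⟨b, antitone_of_interlacing ha hb, rfl⟩)

theorem stateW_of_interlaces {θ : ℝ} {N k : ℕ} {l : Fin (k + 1) → ℝ} {m : Fin k → ℝ}
    (hl : l ∈ stateW θ N (k + 1)) (h : Interlaces θ N m l) : m ∈ stateW θ N k := by
  obtain ⟨a, ha, rfl⟩ := hl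
  obtain ⟨b, hb, rfl⟩ := interlaces_iff.mp h
  exact ⟨b, antitone_of_interlacing ha hb, rfl⟩

/-! ### Summation over Gelfand–Tsetlin patterns. -/

theorem ite_zero_congr {P Q : Prop} {_ : Decidable P} {_ : Decidable Q} (h : P ↔ Q) (x : ℝ≥0∞) :
    (if P then x else 0) = if Q then x else 0 := by
  simp only [h]

/-- Gelfand–Tsetlin patterns with `K` levels inside coordinates shifted by `N`. -/
def levelPatterns (θ : ℝ) (N K : ℕ) : Set (LevelArray K) :=
  {p | (∀ k : Fin (K + 1), p k ∈ stateW θ N k) ∧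
    ∀ k : Fin K, Interlaces θ N (k := (k : ℕ)) (p k.castSucc) (p k.succ)}

/-- The product of the branching factors along a pattern. -/
noncomputable def patternWeight (θ : ℝ) {K : ℕ} (p : LevelArray K) : ℝ :=
  ∏ k : Fin K, jackI θ (k := (k : ℕ)) (p k.succ) (p k.castSucc)

/-- The pattern without its top level. -/
def lowerLevels {K : ℕ} (p : LevelArray (K + 1)) : LevelArray K := fun k => p k.castSucc

/-- The top level of a pattern. -/
def topRow {K : ℕ} (p : LevelArray K) : Fin K → ℝ := p (Fin.last K)

/-- Separating the top level from the lower levels. -/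
def levelSplit (K : ℕ) : LevelArray (K + 1) ≃ (Fin (K + 1) → ℝ) × LevelArray K :=
  (Fin.snocEquiv fun i : Fin (K + 1 + 1) => Fin (i : ℕ) → ℝ).symm

theorem levelSplit_apply {K : ℕ} (p : LevelArray (K + 1)) :
    levelSplit K p = (topRow p, lowerLevels p) := rfl

theorem mem_levelPatterns_succ {θ : ℝ} {N K : ℕ} {p : LevelArray (K + 1)} :
    p ∈ levelPatterns θ N (K + 1) ↔ lowerLevels p ∈ levelPatterns θ N K ∧
      topRow p ∈ stateW θ N (K + 1) ∧ Interlaces θ N (topRow (lowerLevels p)) (topRow p) := by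
  constructor
  · rintro ⟨h1, h2⟩
    exact ⟨⟨fun k => h1 k.castSucc, fun k => h2 k.castSucc⟩, h1 (Fin.last (K + 1)),
      h2 (Fin.last K)⟩
  · rintro ⟨⟨h1, h2⟩, h3, h4⟩
    exact ⟨Fin.forall_fin_succ'.mpr ⟨h1, h3⟩, Fin.forall_fin_succ'.mpr ⟨h2, h4⟩⟩

theorem patternWeight_succ (θ : ℝ) {K : ℕ} (p : LevelArray (K + 1)) :
    patternWeight θ p = patternWeight θ (lowerLevels p) *
      jackI θ (topRow p) (topRow (lowerLevels p)) := by
  rw [patternWeight, Fin.prod_univ_castSucc]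
  rfl

theorem patternWeight_nonneg {θ : ℝ} (hθ : 0 < θ) {N K : ℕ} {p : LevelArray K}
    (hp : p ∈ levelPatterns θ N K) : 0 ≤ patternWeight θ p :=
  Finset.prod_nonneg fun k _ => jackI_nonneg hθ (hp.1 k.succ) (hp.2 k)

open Classical in
/-- The total weight of the patterns with property `Q`. -/
noncomputable def patternTotal (θ : ℝ) (N : ℕ) {K : ℕ} (Q : LevelArray K → Prop) : ℝ≥0∞ :=
  ∑' p : LevelArray K, if p ∈ levelPatterns θ N K ∧ Q p then
    ENNReal.ofReal (patternWeight θ p) else 0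

/-- The total weight of the patterns with top level `l`. -/
noncomputable def patternSum (θ : ℝ) (N : ℕ) {K : ℕ} (l : Fin K → ℝ) : ℝ≥0∞ :=
  patternTotal θ N fun p : LevelArray K => topRow p = l

/-- The total weight of the patterns with top levels `l` and `m`. -/
noncomputable def patternSumTwo (θ : ℝ) (N : ℕ) {K : ℕ} (l : Fin (K + 1) → ℝ) (m : Fin K → ℝ) :
    ℝ≥0∞ :=
  patternTotal θ N fun p : LevelArray (K + 1) => topRow p = l ∧ topRow (lowerLevels p) = m

open Classical in
theorem patternSumTwo_eq {θ : ℝ} (hθ : 0 < θ) {N K : ℕ} {l : Fin (K + 1) → ℝ}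
    (hl : l ∈ stateW θ N (K + 1)) (m : Fin K → ℝ) :
    patternSumTwo θ N l m = if Interlaces θ N m l then
      ENNReal.ofReal (jackI θ l m) * patternSum θ N m else 0 := by
  have h1 : patternSumTwo θ N l m = ∑' z : (Fin (K + 1) → ℝ) × LevelArray K,
      if (z.2 ∈ levelPatterns θ N K ∧ z.1 ∈ stateW θ N (K + 1) ∧
        Interlaces θ N (topRow z.2) z.1) ∧ z.1 = l ∧ topRow z.2 = m then
      ENNReal.ofReal (patternWeight θ z.2 * jackI θ z.1 (topRow z.2)) else 0 := by
    rw [← (levelSplit K).tsum_eq]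
    refine tsum_congr fun p => ?_
    rw [levelSplit_apply, patternWeight_succ]
    exact ite_zero_congr (and_congr_left' mem_levelPatterns_succ) _
  rw [h1, ENNReal.tsum_prod', tsum_eq_single l]
  · split_ifs with h
    · rw [patternSum, patternTotal, ← ENNReal.tsum_mul_left]
      refine tsum_congr fun q => ?_
      by_cases hq : q ∈ levelPatterns θ N K ∧ topRow q = m
      · dsimp only
        rw [if_pos ⟨⟨hq.1, hl, by rw [hq.2]; exact h⟩, rfl, hq.2⟩, if_pos hq, hq.2, mul_comm,
          ENNReal.ofReal_mul (jackI_nonneg hθ hl h)]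
      · rw [if_neg fun h' => hq ⟨h'.1.1, h'.2.2⟩, if_neg hq, mul_zero]
    · rw [ENNReal.tsum_eq_zero]
      intro q
      refine if_neg fun h' => h ?_
      rw [← h'.2.2]
      exact h'.1.2.2
  · intro x hx
    rw [ENNReal.tsum_eq_zero]
    intro q
    exact if_neg fun h' => hx h'.2.1

/-- Each pattern has exactly one next-to-top row, and sums in [0, ∞] may be exchanged freely. -/
theorem patternSum_succ (θ : ℝ) (N : ℕ) {K : ℕ} (l : Fin (K + 1) → ℝ) :
    patternSum θ N l = ∑' m, patternSumTwo θ N l m := by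
  simp only [patternSumTwo, patternTotal]
  rw [ENNReal.tsum_comm, patternSum, patternTotal]
  refine tsum_congr fun p => ?_
  by_cases h : p ∈ levelPatterns θ N (K + 1) ∧ topRow p = l
  · rw [if_pos h, tsum_eq_single (topRow (lowerLevels p)) fun m hm => if_neg fun h' =>
      hm h'.2.2.symm, if_pos ⟨h.1, h.2, rfl⟩]
  · rw [if_neg h, eq_comm, ENNReal.tsum_eq_zero]
    exact fun m => if_neg fun h' => h ⟨h'.1, h'.2.1⟩

/-- The normalizing constant of the branching rule with `K` levels. -/
noncomputable def levelConst (θ : ℝ) (K : ℕ) : ℝ :=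
  ∏ i ∈ Finset.Icc 1 K, Real.Gamma (i * θ) / Real.Gamma θ

theorem levelConst_succ (θ : ℝ) (K : ℕ) :
    levelConst θ (K + 1) =
      levelConst θ K * (Real.Gamma ((K + 1 : ℕ) * θ) / Real.Gamma θ) :=
  Finset.prod_Icc_succ_top (by omega) _

theorem levelConst_pos {θ : ℝ} (hθ : 0 < θ) (K : ℕ) : 0 < levelConst θ K := by
  refine Finset.prod_pos fun i hi => div_pos (Real.Gamma_pos_of_pos ?_) (Real.Gamma_pos_of_pos hθ)
  have : 0 < i := (Finset.mem_Icc.mp hi).1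
  positivity

/-- Induction on the number of levels K with the shift N held fixed; each use of the branching rule
contributes one factor of `levelConst`. -/
theorem patternSum_eq {θ : ℝ} (hθ : 0 < θ) {N K : ℕ} {l : Fin K → ℝ} (hl : l ∈ stateW θ N K) :
    patternSum θ N l = ENNReal.ofReal ((levelConst θ K)⁻¹ * bottomFactor θ l) := by
  classical
  induction K with
  | zero =>
    have hrow (k : Fin (0 + 1)) (x y : Fin (k : ℕ) → ℝ) : x = y := by
      funext i
      have := i.2
      omega
    have hmem (p : LevelArray 0) : p ∈ levelPatterns θ N 0 ∧ topRow p = l :=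
      ⟨⟨fun k => ⟨fun _ => 0, antitone_const, hrow k _ _⟩, fun k => k.elim0⟩, hrow 0 _ _⟩
    rw [patternSum, patternTotal, tsum_eq_single (fun _ _ => 0)
      fun p hp => absurd (funext fun k => hrow k _ _) hp, if_pos (hmem _)]
    simp [patternWeight, levelConst, bottomFactor]
  | succ K ih =>
    have h (m : Fin K → ℝ) : patternSumTwo θ N l m = ENNReal.ofReal (levelConst θ K)⁻¹ *
        if Interlaces θ N m l then ENNReal.ofReal (jackI θ l m * bottomFactor θ m) else 0 := by
      rw [patternSumTwo_eq hθ hl]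
      split_ifs with hm
      · rw [ih (stateW_of_interlaces hl hm), ← ENNReal.ofReal_mul (jackI_nonneg hθ hl hm),
          ← ENNReal.ofReal_mul (inv_nonneg.mpr (levelConst_pos hθ K).le)]
        congr 1
        ring
      · rw [mul_zero]
    rw [patternSum_succ, tsum_congr h, ENNReal.tsum_mul_left, tsum_jackI_mul_bottomFactor hθ hl,
      ← ENNReal.ofReal_mul (inv_nonneg.mpr (levelConst_pos hθ K).le), levelConst_succ]
    congr 1
    rw [mul_inv, inv_div, mul_assoc]

/-! ### The multilevel law and its marginals. -/

theorem multilevelFormula_eq (θ : ℝ) (N : ℕ) (w : ℝ → ℝ) (p : LevelArray N) :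
    multilevelFormula θ N w p = levelConst θ N * (partitionZ θ N w).toReal⁻¹ *
      topFactor θ w (p (Fin.last N)) * patternWeight θ p := by
  simp only [multilevelFormula, levelConst, topFactor, patternWeight]
  rw [← mul_assoc, mul_right_comm]
  rfl

theorem multilevelFormula_nonneg {θ : ℝ} (hθ : 0 < θ) {N : ℕ} {w : ℝ → ℝ} (hw : ∀ x, 0 ≤ w x)
    {p : LevelArray N} (hp : p ∈ patternSpace θ N) : 0 ≤ multilevelFormula θ N w p := by
  rw [multilevelFormula_eq]
  exact mul_nonneg (mul_nonneg (mul_nonneg (levelConst_pos hθ N).le (inv_nonneg.mpr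
    ENNReal.toReal_nonneg)) (topFactor_nonneg hθ hw (hp.1 (Fin.last N))))
    (patternWeight_nonneg hθ hp)

open Classical in
-- Once Q fixes the top row, everything but the branching factors is constant; both marginals are
-- instances. `patternSpace θ N` is `levelPatterns θ N N` by definition.
theorem tsum_multilevel_fiber {θ : ℝ} (hθ : 0 < θ) {N : ℕ} {w : ℝ → ℝ} (hw : ∀ x, 0 ≤ w x)
    {l : Fin N → ℝ} (hl : l ∈ stateW θ N N) (Q : LevelArray N → Prop)
    (hQ : ∀ p, Q p → p (Fin.last N) = l) :
    (∑' p : patternSpace θ N, if Q p.1 then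
      ENNReal.ofReal (multilevelFormula θ N w p.1) else 0) =
    ENNReal.ofReal (levelConst θ N * (partitionZ θ N w).toReal⁻¹ * topFactor θ w l) *
      patternTotal θ N Q := by
  rw [patternTotal, tsum_subtype (patternSpace θ N)
    fun p => if Q p then ENNReal.ofReal (multilevelFormula θ N w p) else 0, ← ENNReal.tsum_mul_left]
  refine tsum_congr fun p => ?_
  have hC : 0 ≤ levelConst θ N * (partitionZ θ N w).toReal⁻¹ * topFactor θ w l :=
    mul_nonneg (mul_nonneg (levelConst_pos hθ N).le (inv_nonneg.mpr
      ENNReal.toReal_nonneg)) (topFactor_nonneg hθ hw hl)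
  by_cases hp : p ∈ patternSpace θ N
  · by_cases hq : Q p
    · rw [Set.indicator_of_mem hp, if_pos hq, if_pos ⟨hp, hq⟩, multilevelFormula_eq, hQ p hq,
        ENNReal.ofReal_mul hC]
    · rw [Set.indicator_of_mem hp, if_neg hq, if_neg fun h => hq h.2, mul_zero]
  · rw [Set.indicator_of_notMem hp, if_neg fun h => hp h.1, mul_zero]

open Classical in
theorem tsum_multilevel_topLevel {θ : ℝ} (hθ : 0 < θ) {N : ℕ} {w : ℝ → ℝ} (hw : ∀ x, 0 ≤ w x)
    (l : stateW θ N N) :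
    (∑' p : patternSpace θ N, if l = topLevel θ N p then
      ENNReal.ofReal (multilevelFormula θ N w p.1) else 0) =
    ENNReal.ofReal ((partitionZ θ N w).toReal⁻¹ * betaWeight θ w l.1) := by
  have h := tsum_multilevel_fiber hθ hw l.2 (fun p => topRow p = l.1) fun p hp => hp
  rw [← patternSum, patternSum_eq hθ l.2, ← ENNReal.ofReal_mul (mul_nonneg (mul_nonneg (levelConst_pos hθ N).le (inv_nonneg.mpr
    ENNReal.toReal_nonneg)) (topFactor_nonneg hθ hw l.2))] at h
  rw [betaWeight_eq]
  convert h using 2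
  · funext p
    exact ite_zero_congr (Subtype.ext_iff.trans eq_comm) _
  · have := (levelConst_pos hθ N).ne'
    field_simp

theorem tsum_multilevelFormula {θ : ℝ} (hθ : 0 < θ) {N : ℕ} {w : ℝ → ℝ} (hw : ∀ x, 0 ≤ w x)
    (hZpos : 0 < partitionZ θ N w) (hZfin : partitionZ θ N w < ∞) :
    ∑' p : patternSpace θ N, ENNReal.ofReal (multilevelFormula θ N w p.1) = 1 := by
  classical
  have h (p : patternSpace θ N) : ENNReal.ofReal (multilevelFormula θ N w p.1) =
      ∑' l : stateW θ N N, if l = topLevel θ N p then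
        ENNReal.ofReal (multilevelFormula θ N w p.1) else 0 := by
    rw [tsum_ite_eq]
  -- Grouping patterns by top row reduces the total mass to the β-ensemble weights, whose sum is Z.
  rw [tsum_congr h, ENNReal.tsum_comm, tsum_congr (tsum_multilevel_topLevel hθ hw)]
  have hZ : 0 < (partitionZ θ N w).toReal := ENNReal.toReal_pos hZpos.ne' hZfin.ne
  simp only [ENNReal.ofReal_mul (inv_nonneg.mpr hZ.le)]
  rw [ENNReal.tsum_mul_left, ← partitionZ, ENNReal.ofReal_inv_of_pos hZ,
    ENNReal.ofReal_toReal hZfin.ne, ENNReal.inv_mul_cancel hZpos.ne' hZfin.ne]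

open Classical in
theorem tsum_multilevel_topTwoLevels {θ : ℝ} (hθ : 0 < θ) {n : ℕ} {w : ℝ → ℝ}
    (hw : ∀ x, 0 ≤ w x) (q : twoLevelSpace θ n) :
    (∑' p : patternSpace θ (n + 1), if q = topTwoLevels θ n p then
      ENNReal.ofReal (multilevelFormula θ (n + 1) w p.1) else 0) =
    ENNReal.ofReal
      (Real.Gamma (((n + 1 : ℕ) : ℝ) * θ) / Real.Gamma θ * (partitionZ θ (n + 1) w).toReal⁻¹ *
        topFactor θ w q.1.1 * bottomFactor θ q.1.2 * jackI θ q.1.1 q.1.2) := by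
  obtain ⟨⟨l, m⟩, hl, hm, hlm⟩ := q
  have h := tsum_multilevel_fiber hθ hw hl
    (fun p => topRow p = l ∧ topRow (lowerLevels p) = m) fun p hp => hp.1
  rw [← patternSumTwo, patternSumTwo_eq hθ hl, if_pos hlm, patternSum_eq hθ hm,
    ← ENNReal.ofReal_mul (jackI_nonneg hθ hl hlm), ← ENNReal.ofReal_mul (mul_nonneg (mul_nonneg (levelConst_pos hθ _).le (inv_nonneg.mpr
    ENNReal.toReal_nonneg)) (topFactor_nonneg hθ hw hl)), levelConst_succ] at h
  convert h using 2
  · funext p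
    exact ite_zero_congr
      (Subtype.ext_iff.trans (Prod.ext_iff.trans (and_congr eq_comm eq_comm))) _
  -- The constant of n levels cancels against that of n + 1 levels, leaving Γ((n+1)θ)/Γ(θ).
  · have := (levelConst_pos hθ n).ne'
    field_simp

/-- The multilevel distribution. -/
noncomputable def multilevelPMF {θ : ℝ} (hθ : 0 < θ) {N : ℕ} {w : ℝ → ℝ} (hw : ∀ x, 0 ≤ w x)
    (hZpos : 0 < partitionZ θ N w) (hZfin : partitionZ θ N w < ∞) : PMF (patternSpace θ N) :=
  ⟨fun p => ENNReal.ofReal (multilevelFormula θ N w p.1),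
    ENNReal.summable.hasSum_iff.mpr (tsum_multilevelFormula hθ hw hZpos hZfin)⟩

theorem mainTheorem6 (n : ℕ) (θ : ℝ) (hθ : 0 < θ) (w : ℝ → ℝ) (hw : ∀ x, 0 ≤ w x)
    (hZpos : 0 < partitionZ θ (n + 1) w) (hZfin : partitionZ θ (n + 1) w < ∞) :
    (∀ p ∈ patternSpace θ (n + 1), 0 ≤ multilevelFormula θ (n + 1) w p) ∧
    ∃ P : PMF (patternSpace θ (n + 1)),
      (∀ p : patternSpace θ (n + 1),
        P p = ENNReal.ofReal (multilevelFormula θ (n + 1) w p.1)) ∧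
      (∀ l : stateW θ (n + 1) (n + 1),
        P.map (topLevel θ (n + 1)) l =
          ENNReal.ofReal ((partitionZ θ (n + 1) w).toReal⁻¹ * betaWeight θ w l.1)) ∧
      (∀ q : twoLevelSpace θ n,
        P.map (topTwoLevels θ n) q =
          ENNReal.ofReal
            (Real.Gamma (((n + 1 : ℕ) : ℝ) * θ) / Real.Gamma θ *
              (partitionZ θ (n + 1) w).toReal⁻¹ *
              topFactor θ w q.1.1 * bottomFactor θ q.1.2 * jackI θ q.1.1 q.1.2)) := by
  refine ⟨fun p hp => multilevelFormula_nonneg hθ hw hp,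
    multilevelPMF hθ hw hZpos hZfin, fun p => rfl, fun l => ?_, fun q => ?_⟩
  · rw [PMF.map_apply]
    exact (tsum_congr fun p => ite_zero_congr Iff.rfl _).trans
      (tsum_multilevel_topLevel hθ hw l)
  · rw [PMF.map_apply]
    exact (tsum_congr fun p => ite_zero_congr Iff.rfl _).trans
      (tsum_multilevel_topTwoLevels hθ hw q)
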